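/- For a commutative ring $R$, let $\operatorname{HTP}(R)\subseteq\mathbb{N}$ be the set of indices $e$ such that $f_e$ has a zero with coordinates in $R$, where $f_0,f_1,\ldots$ is a fixed computable enumeration of all polynomials with integer coefficients in any finite number of variables. For a set $\mathcal S$ of primes, let $\mathbb{Z}[\mathcal S^{-1}]$ be the subring of $\mathbb{Q}$ generated by the inverses of the primes in $\mathcal S$. The lower density of $\mathcal S$ is $\liminf_{n\to\infty}\frac{|\mathcal S\cap\{p_1,\ldots,p_n\}|}{n}$, where $p_1<p_2<\cdots$ are all the primes in increasing order. There exist infinitely many pairwise disjoint and distinct sets $\mathcal S_0,\mathcal S_1,\mathcal S_2,\ldots$ of primes whose union is the set of all primes, such that: 1. every $\mathcal S_j$ has lower density $0$; 2. the sets $\mathcal S_j$ are uniformly computable from an $\operatorname{HTP}(\mathbb{Q})$-oracle, that is, $\{(j,n) : n\in\mathcal S_j\}$ is decidable with an oracle for $\operatorname{HTP}(\mathbb{Q})$; likewise the rings $\mathbb{Z}[\mathcal S_j^{-1}]$ are uniformly computable from $\operatorname{HTP}(\mathbb{Q})$, that is, $\{(j,a,b)\in\mathbb{N}\times\mathbb{Z}\times\mathbb{N}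 : b\neq 0,\ a/b\in\mathbb{Z}[\mathcal S_j^{-1}]\}$ is decidable with an oracle for $\operatorname{HTP}(\mathbb{Q})$; 3. $\operatorname{HTP}(\mathbb{Z}[\mathcal S_j^{-1}])$ is Turing equivalent to $\operatorname{HTP}(\mathbb{Q})$ for every $j$. -/

import Mathlib

open scoped Computability

/-- The polynomial in `ℤ[X₀, X₁, …]` given by a finite list of terms: the pair `(c, [e₀, …, eₖ])`
stands for the term `c * X₀ ^ e₀ * ⋯ * Xₖ ^ eₖ`, and the polynomial is the sum of the terms. -/
noncomputable def polyOfTerms (l : List (ℤ × List ℕ)) : MvPolynomial ℕ ℤ :=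
  (l.map fun t => MvPolynomial.monomial t.2.toFinsupp t.1).sum

/-- A computable enumeration `f₀, f₁, …` of `ℤ[X₀, X₁, …]`: the index `e` is decoded, by Mathlib's
primitive recursive coding of lists and pairs, to the list of terms of `fₑ`. -/
noncomputable def polyEnum (e : ℕ) : MvPolynomial ℕ ℤ :=
  polyOfTerms (Denumerable.ofNat (List (ℤ × List ℕ)) e)

/-- Every polynomial with integer coefficients, in any number of variables, has an index. -/
theorem polyEnum_surjective : Function.Surjective polyEnum := by
  suffices h : ∀ f : MvPolynomial ℕ ℤ, ∃ l, polyOfTerms l = f by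
    intro f
    obtain ⟨l, rfl⟩ := h f
    exact ⟨Encodable.encode l, by rw [polyEnum, Denumerable.ofNat_encode]⟩
  intro f
  induction f using MvPolynomial.induction_on' with
  | monomial s c =>
    refine ⟨[(c, (List.range (s.support.sup id + 1)).map s)], ?_⟩
    have h : ((List.range (s.support.sup id + 1)).map s).toFinsupp = s := by
      ext i
      rw [List.toFinsupp_apply, List.getD_eq_getElem?_getD]
      by_cases hi : i < s.support.sup id + 1
      · simp [hi]
      · have h0 : s i = 0 := by
          by_contra h1
          have := Finset.le_sup (f := id) (Finsupp.mem_support_iff.2 h1)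
          simp only [id] at this
          exact hi (Nat.lt_succ_of_le this)
        simp [hi, h0]
    simp [polyOfTerms, h]
  | add p q ih ih' =>
    obtain ⟨l, hl⟩ := ih
    obtain ⟨l', hl'⟩ := ih'
    exact ⟨l ++ l', by rw [← hl, ← hl']; simp [polyOfTerms]⟩

/-- Hilbert's tenth problem for a commutative ring `R`: the set of indices of those polynomials with
integer coefficients that have a zero in `R`. -/
def HTP (R : Type*) [CommRing R] : Set ℕ :=
  {e | ∃ x : ℕ → R, MvPolynomial.aeval x (polyEnum e) = 0}

/-- The ring `ℤ[S⁻¹]`, the subring of `ℚ` generated by the inverses of the elements of `S`. -/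
def invertedRing (S : Set ℕ) : Subring ℚ :=
  Subring.closure ((fun p : ℕ => (p : ℚ)⁻¹) '' S)

open scoped Classical in
/-- The characteristic function of a set. -/
noncomputable def charFun {α : Type*} (A : Set α) (a : α) : ℕ :=
  if a ∈ A then 1 else 0

/-- `A` and `B` are Turing equivalent: each characteristic function is computable with the other
as an oracle. -/
def SetTuringEquivalent (A B : Set ℕ) : Prop :=
  (charFun A : ℕ →. ℕ) ≡ᵀ (charFun B : ℕ →. ℕ)

/-- The set `A` can be decided with an oracle for `B`. -/
def DecidableFrom {α : Type*} [Primcodable α] (B : Set ℕ) (A : Set α) : Prop :=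
  ComputableIn {(charFun B : ℕ →. ℕ)} (charFun A)

/-- The lower density of a set of primes: the lower limit, as `n` tends to infinity, of the
proportion of the first `n` primes that lie in `S`. -/
noncomputable def lowerDensity (S : Set ℕ) : ℝ :=
  Filter.liminf
    (fun n : ℕ => ((S ∩ Nat.nth Nat.Prime '' Set.Iio n).ncard : ℝ) / n) Filter.atTop

/-! All natural numbers are coloured, and the classes are the primes of each colour, so covering and
disjointness are automatic. The colouring grows by finite stages s = ⟨e, j⟩, each of which decides
for good whether `f_e` has a zero in the ring of colour j. Let P be the product of the primes
already given a colour other than j. If no rational zero of `f_e` has all denominators coprime to P,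
there is no zero in that ring, however the colouring continues. Otherwise a search finds such a
zero, with common denominator b, and the next b + 1 numbers get colour j; no prime divisor of b is
then left uncoloured, so the zero lies in the ring. A block of colour s follows, so long that every
other colour has at most the fraction 1/(s + 1) of the primes below its end. Lower density 0
follows.

For this to be computable from HTP(ℚ), the question about P must become a single equation over ℚ,
obtained effectively from P. Choose d with ℚ(√d) inert at every prime p dividing P. Norms from ℚ(√d)
have even p-valuation, and P is squarefree, so if 1 + P(n² - d v²) is a norm then n is p-integral up
to a factor 2. Conversely, for an integer n divisible by 2d some v always makes it a norm, by
Dirichlet's theorem, quadratic reciprocity and Legendre's theorem. With n = 2da³ this defines a set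
of a lying between ℤ and the semilocal ring, and the quotients a/(1 + Pe) of such elements fill that
ring (`InertAt.coprime_den_iff`).

In the other direction, HTP(ℚ) reduces to HTP(R) for every subring R of ℚ: homogenize, and express
that the last coordinate is nonzero by four squares (`exists_zero_homQuery_iff`). -/

/-! ### Legendre's theorem and a quaternary form -/

/-- Pigeonhole: the box with sides √(bc), √(ca), √(ab) has more than abc integer points, so two of
them agree in all three congruences; their difference is the required point. -/
theorem exists_small_lattice_point {a b c : ℕ} (ha : 0 < a) (hb : 0 < b) (hc : 0 < c)
    (r₁ r₂ r₃ : ℤ) :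
    ∃ s w v : ℤ, (s ≠ 0 ∨ w ≠ 0 ∨ v ≠ 0) ∧ s ^ 2 ≤ b * c ∧ w ^ 2 ≤ c * a ∧ v ^ 2 ≤ a * b ∧
      (a : ℤ) ∣ w - r₁ * v ∧ (b : ℤ) ∣ s - r₂ * v ∧ (c : ℤ) ∣ s - r₃ * w := by
  have : NeZero a := ⟨ha.ne'⟩
  have : NeZero b := ⟨hb.ne'⟩
  have : NeZero c := ⟨hc.ne'⟩
  let box : Finset (ℕ × ℕ × ℕ) := Finset.range (Nat.sqrt (b * c) + 1) ×ˢ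
    Finset.range (Nat.sqrt (c * a) + 1) ×ˢ Finset.range (Nat.sqrt (a * b) + 1)
  let f : ℕ × ℕ × ℕ → ZMod a × ZMod b × ZMod c := fun x =>
    (((x.2.1 - r₁ * x.2.2 : ℤ) : ZMod a), ((x.1 - r₂ * x.2.2 : ℤ) : ZMod b),
      ((x.1 - r₃ * x.2.1 : ℤ) : ZMod c))
  have hcard : (Finset.univ : Finset (ZMod a × ZMod b × ZMod c)).card < box.card := by
    simp only [box, Finset.card_product, Finset.card_range, Finset.card_univ, Fintype.card_prod,
      ZMod.card]
    have h1 := Nat.lt_succ_sqrt (b * c)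
    have h2 := Nat.lt_succ_sqrt (c * a)
    have h3 := Nat.lt_succ_sqrt (a * b)
    simp only [Nat.succ_eq_add_one] at h1 h2 h3
    refine lt_of_pow_lt_pow_left₀ 2 (Nat.zero_le _) ?_
    calc (a * (b * c)) ^ 2 = (b * c) * ((c * a) * (a * b)) := by ring
      _ < _ := mul_lt_mul'' h1 (mul_lt_mul'' h2 h3 (Nat.zero_le _) (Nat.zero_le _))
          (Nat.zero_le _) (Nat.zero_le _)
      _ = _ := by ring
  obtain ⟨x, hx, y, hy, hxy, hf⟩ :=
    Finset.exists_ne_map_eq_of_card_lt_of_maps_to hcard (f := f) (fun _ _ => Finset.mem_univ _)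
  have bound : ∀ {n i j : ℕ}, i < Nat.sqrt n + 1 → j < Nat.sqrt n + 1 →
      ((i : ℤ) - j) ^ 2 ≤ n := by
    intro n i j hi hj
    have h := Nat.sqrt_le n
    have h' : ((Nat.sqrt n : ℤ)) * Nat.sqrt n ≤ n := by exact_mod_cast h
    have habs : |(i : ℤ) - j| ≤ Nat.sqrt n := by rw [abs_le]; constructor <;> omega
    calc ((i : ℤ) - j) ^ 2 ≤ (Nat.sqrt n : ℤ) ^ 2 := sq_le_sq' (by
          have := (abs_le.1 habs).1; linarith) (abs_le.1 habs).2
      _ ≤ n := by rw [sq]; exact h'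
  simp only [box, Finset.mem_product, Finset.mem_range] at hx hy
  simp only [f, Prod.mk.injEq, ZMod.intCast_eq_intCast_iff_dvd_sub] at hf
  refine ⟨x.1 - y.1, x.2.1 - y.2.1, x.2.2 - y.2.2, ?_, ?_, ?_, ?_, ?_, ?_, ?_⟩
  · by_contra! h
    obtain ⟨h1, h2, h3⟩ := h
    exact hxy (Prod.ext (by omega) (Prod.ext (by omega) (by omega)))
  · exact_mod_cast bound hx.1 hy.1
  · exact_mod_cast bound hx.2.1 hy.2.1
  · exact_mod_cast bound hx.2.2 hy.2.2
  · obtain ⟨t, ht⟩ := hf.1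
    exact ⟨-t, by linear_combination -ht⟩
  · obtain ⟨t, ht⟩ := hf.2.1
    exact ⟨-t, by linear_combination -ht⟩
  · obtain ⟨t, ht⟩ := hf.2.2
    exact ⟨-t, by linear_combination -ht⟩

theorem Nat.Prime.not_isSquare_mul {b c : ℕ} (hb : b.Prime) (h : ¬ b ∣ c) (s : ℤ) :
    s ^ 2 ≠ b * c := by
  intro hs
  have hs' : s.natAbs ^ 2 = b * c := by zify; rw [sq_abs]; exact hs
  have h1 : b ∣ s.natAbs := hb.dvd_of_dvd_pow (hs' ▸ dvd_mul_right b c)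
  obtain ⟨t, ht⟩ := h1
  rw [ht] at hs'
  have : b * t ^ 2 = c := Nat.eq_of_mul_eq_mul_left hb.pos (by rw [← hs']; ring)
  exact h ⟨_, this.symm⟩

/-- A case of Legendre's theorem on ternary quadratic forms. -/
theorem exists_zero_ternary_form {a b c : ℕ} (ha : 0 < a) (hb : b.Prime) (hc : 0 < c)
    (hab : a.Coprime b) (hbc : b.Coprime c) (hca : c.Coprime a) {r₁ r₂ r₃ : ℤ}
    (h₁ : (a : ℤ) ∣ b * r₁ ^ 2 + c) (h₂ : (b : ℤ) ∣ a * r₂ ^ 2 - c)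
    (h₃ : (c : ℤ) ∣ a * r₃ ^ 2 - b) :
    ∃ s w v : ℤ, (s ≠ 0 ∨ w ≠ 0 ∨ v ≠ 0) ∧ a * s ^ 2 = b * w ^ 2 + c * v ^ 2 := by
  obtain ⟨s, w, v, hne, hs, hw, hv, k₁, k₂, k₃⟩ :=
    exists_small_lattice_point ha hb.pos hc r₁ r₂ r₃
  have d₁ : (a : ℤ) ∣ a * s ^ 2 - b * w ^ 2 - c * v ^ 2 := by
    have : a * s ^ 2 - b * w ^ 2 - c * v ^ 2 = a * s ^ 2 - (b * r₁ ^ 2 + c) * v ^ 2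
      - (w - r₁ * v) * (b * (w + r₁ * v)) := by ring
    rw [this]
    exact ((dvd_mul_right _ _).sub (h₁.mul_right _)).sub (k₁.mul_right _)
  have d₂ : (b : ℤ) ∣ a * s ^ 2 - b * w ^ 2 - c * v ^ 2 := by
    have : a * s ^ 2 - b * w ^ 2 - c * v ^ 2 = (s - r₂ * v) * (a * (s + r₂ * v)) - b * w ^ 2
      + (a * r₂ ^ 2 - c) * v ^ 2 := by ring
    rw [this]
    exact ((k₂.mul_right _).sub (dvd_mul_right _ _)).add (h₂.mul_right _)
  have d₃ : (c : ℤ) ∣ a * s ^ 2 - b * w ^ 2 - c * v ^ 2 := by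
    have : a * s ^ 2 - b * w ^ 2 - c * v ^ 2 = (s - r₃ * w) * (a * (s + r₃ * w)) - c * v ^ 2
      + (a * r₃ ^ 2 - b) * w ^ 2 := by ring
    rw [this]
    exact ((k₃.mul_right _).sub (dvd_mul_right _ _)).add (h₃.mul_right _)
  have dd : (a * b * c : ℤ) ∣ a * s ^ 2 - b * w ^ 2 - c * v ^ 2 := by
    refine IsCoprime.mul_dvd ?_ (IsCoprime.mul_dvd ?_ d₁ d₂) d₃
    · exact (Nat.isCoprime_iff_coprime.2 hca.symm).mul_left (Nat.isCoprime_iff_coprime.2 hbc)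
    · exact Nat.isCoprime_iff_coprime.2 hab
  have ha' : (0 : ℤ) < a := by exact_mod_cast ha
  have hb' : (0 : ℤ) < b := by exact_mod_cast hb.pos
  have hc' : (0 : ℤ) < c := by exact_mod_cast hc
  have hs' : s ^ 2 < b * c := lt_of_le_of_ne hs
    (hb.not_isSquare_mul ((hb.coprime_iff_not_dvd).1 hbc) s)
  have hv' : v ^ 2 < a * b := lt_of_le_of_ne hv (by
    rw [mul_comm]
    exact hb.not_isSquare_mul ((hb.coprime_iff_not_dvd).1 hab.symm) v)
  obtain ⟨t, ht⟩ := dd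
  have q1 : a * s ^ 2 < a * (b * c) := by gcongr
  have q2 : b * w ^ 2 ≤ b * (c * a) := by gcongr
  have q3 : c * v ^ 2 < c * (a * b) := by gcongr
  have p1 : 0 ≤ a * s ^ 2 := by positivity
  have p2 : 0 ≤ b * w ^ 2 := by positivity
  have p3 : 0 ≤ c * v ^ 2 := by positivity
  have hN : (0 : ℤ) < a * b * c := by positivity
  -- The value of the form is a multiple of abc lying strictly between -2abc and abc, hence 0 or
  -- -abc. Primality of b made the bounds on s² and v² strict.
  have ht1 : t < 1 := by
    by_contra! h
    nlinarith
  have ht2 : -2 < t := by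
    by_contra! h
    nlinarith
  obtain rfl | rfl : t = 0 ∨ t = -1 := by omega
  · exact ⟨s, w, v, hne, by linarith⟩
  -- Here a(s² + bc) = bw² + cv². Multiplying by s² + bc and composing the two forms gives b(ws +
  -- cv)² + c(vs - bw)² on the right.
  · refine ⟨s ^ 2 + b * c, w * s + c * v, v * s - b * w, Or.inl (by positivity), ?_⟩
    have key : (b * w ^ 2 + c * v ^ 2 : ℤ) = a * (s ^ 2 + b * c) := by linarith
    linear_combination (-(s ^ 2 + b * c) : ℤ) * key

open scoped NumberTheorySymbols in
/-- If `d` is not a square and `2 * d ∣ n`, then `1` is represented by the quaternary form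
`y² - d z² - P (n² - d v²)` with the coordinate `n` prescribed. -/
theorem exists_quaternary_form_eq_one {P d : ℕ} (hP : 0 < P) (hd : 0 < d) (hds : ¬ IsSquare d) {n : ℕ}
    (hn : 2 * d ∣ n) :
    ∃ v y z : ℚ, 1 + (P : ℚ) * n ^ 2 - P * d * v ^ 2 = y ^ 2 - d * z ^ 2 := by
  obtain ⟨M, hM⟩ : ∃ M, M = 1 + P * n ^ 2 := ⟨_, rfl⟩
  have hM0 : 0 < M := by omega
  have h4 : 4 * (P * d) ∣ P * n ^ 2 := by
    obtain ⟨k, rfl⟩ := hn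
    exact ⟨d * k ^ 2, by ring⟩
  have hM1 : M ≡ 1 [MOD 4 * (P * d)] := by
    rw [hM, add_comm]
    exact (Nat.modEq_zero_iff_dvd.2 h4).add_right 1
  have hcop : (4 * (P * d)).Coprime M := by
    rw [Nat.coprime_comm, Nat.Coprime, hM1.gcd_eq, Nat.gcd_one_left]
  have hPdM : (P * d).Coprime M := hcop.coprime_dvd_left (dvd_mul_left _ _)
  -- Since P n² ≡ -1 modulo M, the second residue is -Pd, written without subtraction.
  obtain ⟨x, hx1, hx2⟩ := Nat.chineseRemainder hcop 1 (P * n ^ 2 * (P * d))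
  have hxcop : x.Coprime (4 * (P * d) * M) := by
    refine Nat.Coprime.mul_right ?_ ?_
    · rw [Nat.Coprime, hx1.gcd_eq, Nat.gcd_one_left]
    · rw [Nat.Coprime, hx2.gcd_eq]
      refine Nat.Coprime.mul_left ?_ hPdM
      rw [hM]
      simp
  have hq0 : 4 * (P * d) * M ≠ 0 := by positivity
  -- The prime l links two ternary forms: M - Pdv² will be l times a square, and l a norm from ℚ(√d)
  -- up to squares. As l ≡ 1 mod 4Pd, every divisor of Pd is a residue modulo l; as l ≡ -Pd mod M,
  -- the local condition at M holds.
  obtain ⟨l, hlgt, hl, hlx⟩ := Nat.forall_exists_prime_gt_and_modEq (4 * (P * d) * M) hq0 hxcop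
  have hl1 : l ≡ 1 [MOD 4 * (P * d)] := (hlx.of_mul_right _).trans hx1
  have hl2 : l ≡ P * n ^ 2 * (P * d) [MOD M] := (hlx.of_mul_left _).trans hx2
  have hl2' : (M : ℤ) ∣ l + P * d := by
    have h := (Nat.modEq_iff_dvd.1 hl2)
    obtain ⟨k, hk⟩ := h
    refine ⟨P * d - k, ?_⟩
    rw [hM] at hk ⊢
    push_cast at hk ⊢
    linear_combination -hk
  have hl4 : l % 4 = 1 := hl1.of_mul_right _
  have hlPd : l ≡ 1 [MOD P * d] := hl1.of_mul_left _
  have hld : l ≡ 1 [MOD d] := hlPd.of_mul_left _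
  have hMPd : M ≡ 1 [MOD P * d] := hM1.of_mul_left _
  have : Fact l.Prime := ⟨hl⟩
  have hlodd : Odd l := Nat.odd_iff.2 (by omega)
  have hModd : Odd M := by
    have : M % 4 = 1 := hM1.of_mul_right _
    exact Nat.odd_iff.2 (by omega)
  have J1 : ∀ a : ℕ, a ∣ P * d → J(a | l) = 1 := by
    rintro a ha
    rw [jacobiSym.mod_right' a hlodd]
    have h : l ≡ 1 [MOD 4 * a] := hl1.of_dvd (Nat.mul_dvd_mul_left 4 ha)
    have h' : J((a : ℤ) | 1 % (4 * a)) = 1 := by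
      rw [← jacobiSym.mod_right' a odd_one, jacobiSym.one_right]
    rwa [show l % (4 * a) = 1 % (4 * a) from h]
  -- By reciprocity this is (-Pd | M). The factor (d | M) is 1 because M ≡ 1 mod 4d, and (-P | M) is
  -- 1 because -P n² ≡ 1 mod M.
  have JM : J((M : ℤ) | l) = 1 := by
    rw [jacobiSym.quadratic_reciprocity_one_mod_four' hModd hl4]
    have h1 : J((l : ℤ) | M) = J(-P * d | M) := by
      refine jacobiSym.mod_left' ?_
      refine Int.ModEq.symm ((Int.modEq_iff_dvd).2 ?_)
      convert hl2' using 1; ring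
    have h2 : J((d : ℤ) | M) = 1 := by
      rw [jacobiSym.mod_right' d hModd]
      have h : M ≡ 1 [MOD 4 * d] := hM1.of_dvd ⟨P, by ring⟩
      have h' : J((d : ℤ) | 1 % (4 * d)) = 1 := by
        rw [← jacobiSym.mod_right' d odd_one, jacobiSym.one_right]
      rwa [show M % (4 * d) = 1 % (4 * d) from h]
    have h3 : J(-(P : ℤ) | M) = 1 := by
      have hnM : (n : ℤ).gcd M = 1 := by
        rw [Int.gcd_natCast_natCast, hM]
        have : n.Coprime (1 + P * n ^ 2) := by
          rw [show 1 + P * n ^ 2 = 1 + n * (P * n) by ring]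
          simp
        exact this
      have h4 : J(-(P : ℤ) * (n : ℤ) ^ 2 | M) = J(1 | M) := by
        refine jacobiSym.mod_left' ((Int.modEq_iff_dvd).2 ⟨1, ?_⟩)
        rw [hM]; push_cast; ring
      rwa [jacobiSym.mul_left, jacobiSym.sq_one' hnM, mul_one, jacobiSym.one_left] at h4
    rw [h1, jacobiSym.mul_left, h2, h3, mul_one]
  have hlM : ¬ l ∣ M := fun h => by
    have h1 := Nat.le_of_dvd hM0 h
    have : M ≤ 4 * (P * d) * M := Nat.le_mul_of_pos_left _ (by positivity)
    omega
  have hlPd' : l.Coprime (P * d) := by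
    rw [Nat.Coprime, hlPd.gcd_eq, Nat.gcd_one_left]
  have hMl : M.Coprime l := ((hl.coprime_iff_not_dvd).2 hlM).symm
  obtain ⟨r, hr⟩ : ∃ r : ℤ, (l : ℤ) ∣ M * r ^ 2 - (P * d : ℕ) := by
    have hsq : IsSquare (((P * d : ℕ) * M : ℤ) : ZMod l) :=
      ZMod.isSquare_of_jacobiSym_eq_one (by rw [jacobiSym.mul_left, J1 _ dvd_rfl, JM, mul_one])
    obtain ⟨t, ht⟩ := hsq
    obtain ⟨r, hr⟩ := ZMod.intCast_surjective (t / (M : ZMod l))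
    have hM' : (M : ZMod l) ≠ 0 := by rwa [Ne, ZMod.natCast_eq_zero_iff]
    refine ⟨r, ?_⟩
    rw [← ZMod.intCast_zmod_eq_zero_iff_dvd]
    push_cast at ht ⊢
    rw [hr]
    field_simp
    linear_combination -ht
  obtain ⟨s, w, v, hne, h⟩ := exists_zero_ternary_form hM0 hl (c := P * d) (by positivity) hMl hlPd'
    hPdM (r₁ := 1) (r₂ := r) (r₃ := 1) (by simpa using hl2') hr (by
      have := (Nat.modEq_iff_dvd.1 (hlPd.trans hMPd.symm))
      simpa using this)
  obtain ⟨r', hr'⟩ : ∃ r : ℤ, (l : ℤ) ∣ r ^ 2 - d := by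
    obtain ⟨t, ht⟩ := ZMod.isSquare_of_jacobiSym_eq_one (J1 d (dvd_mul_left _ _))
    obtain ⟨r, hr⟩ := ZMod.intCast_surjective t
    refine ⟨r, ?_⟩
    rw [← ZMod.intCast_zmod_eq_zero_iff_dvd]
    push_cast at ht ⊢
    rw [hr]
    linear_combination -ht
  obtain ⟨y, w', z, hne', h'⟩ := exists_zero_ternary_form (a := 1) one_pos hl (c := d) hd
    (Nat.coprime_one_left _) (hlPd'.coprime_dvd_right (dvd_mul_left _ _))
    (Nat.coprime_one_right _) (r₁ := 1) (r₂ := r') (r₃ := 1) (by simp) (by simpa using hr') (by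
      have := (Nat.modEq_iff_dvd.1 hld)
      simpa using this)
  have hs : s ≠ 0 := by
    rintro rfl
    have e1 : 0 ≤ (l : ℤ) * w ^ 2 := by positivity
    have e2 : 0 ≤ ((P * d : ℕ) : ℤ) * v ^ 2 := by positivity
    have hl0 : (l : ℤ) ≠ 0 := by exact_mod_cast hl.ne_zero
    have hPd0 : ((P * d : ℕ) : ℤ) ≠ 0 := by positivity
    have e3 : (l : ℤ) * w ^ 2 = 0 := by linarith
    have e4 : ((P * d : ℕ) : ℤ) * v ^ 2 = 0 := by linarith
    simp only [mul_eq_zero, hl0, hPd0, false_or, pow_eq_zero_iff, ne_eq, OfNat.ofNat_ne_zero,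
      not_false_eq_true] at e3 e4
    simp [e3, e4] at hne
  have hw : w' ≠ 0 := by
    rintro rfl
    have hz : z ≠ 0 := by
      rintro rfl
      have : y = 0 := by simpa using h'
      simp [this] at hne'
    refine hds ?_
    have hd2 : (d : ℚ) = (y / z) * (y / z) := by
      have : (z : ℚ) ≠ 0 := by exact_mod_cast hz
      field_simp
      have h'' : (y : ℚ) ^ 2 = d * z ^ 2 := by exact_mod_cast (by simpa using h')
      linarith
    exact Rat.isSquare_natCast_iff.1 ⟨_, hd2⟩
  -- M - Pd(v/s)² = l(w/s)², and l is the norm of (y + z√d)/w'.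
  refine ⟨v / s, w / s * (y / w'), w / s * (z / w'), ?_⟩
  have hs' : (s : ℚ) ≠ 0 := by exact_mod_cast hs
  have hw' : (w' : ℚ) ≠ 0 := by exact_mod_cast hw
  have hq : (M : ℚ) * s ^ 2 = l * w ^ 2 + P * d * v ^ 2 := by exact_mod_cast h
  have hq' : (y : ℚ) ^ 2 = l * w' ^ 2 + d * z ^ 2 := by
    have : (1 : ℚ) * y ^ 2 = l * w' ^ 2 + d * z ^ 2 := by exact_mod_cast h'
    linarith
  have hMq : (1 + P * n ^ 2 : ℚ) = M := by rw [hM]; push_cast; ring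
  rw [hMq]
  field_simp
  linear_combination w' ^ 2 * hq - w ^ 2 * hq'

/-! ### Inert quadratic fields and semilocal subrings of ℚ -/

/-- `ℚ(√d)` is inert at every prime dividing `P`, in the form of congruence conditions. -/
def InertAt (P d : ℕ) : Prop :=
  d % 8 = 5 ∧ ∀ p ≤ P, p.Prime → p ∣ P → p ≠ 2 → ∀ y < p, (y * y) % p ≠ d % p

/-- Chinese remainder theorem, with the residue 5 modulo 8 and a nonresidue modulo each odd prime
divisor of P. -/
theorem exists_inertAt (P : ℕ) : ∃ d, InertAt P d := by
  classical
  have hex : ∀ p : ℕ, ∃ a : ℕ, p.Prime → p ≠ 2 → ∀ y < p, (y * y) % p ≠ a % p := by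
    intro p
    by_cases hp : p.Prime ∧ p ≠ 2
    · obtain ⟨hp, hp2⟩ := hp
      have : Fact p.Prime := ⟨hp⟩
      obtain ⟨a, ha⟩ := FiniteField.exists_nonsquare (F := ZMod p) (by rwa [ZMod.ringChar_zmod_n])
      refine ⟨a.val, fun _ _ y _ h => ha ⟨y, ?_⟩⟩
      have := (ZMod.natCast_eq_natCast_iff' _ _ _).2 h
      rw [ZMod.natCast_zmod_val] at this
      rw [← this]; push_cast; rfl
    · exact ⟨0, fun h1 h2 => absurd ⟨h1, h2⟩ hp⟩
  choose a ha using hex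
  obtain ⟨d, hd⟩ := Nat.chineseRemainderOfFinset (fun p => if p = 2 then 5 else a p)
    (fun p => if p = 2 then 8 else p) (insert 2 P.primeFactors) (by
      intro p hp
      by_cases h : p = 2
      · simp [h]
      · simp only [h, if_false]
        simp only [Finset.mem_insert, h, false_or] at hp
        exact (Nat.prime_of_mem_primeFactors hp).ne_zero) (by
      have key : ∀ p ∈ insert 2 P.primeFactors, p.Prime := by
        intro p hp
        rcases Finset.mem_insert.1 hp with rfl | hp
        · exact Nat.prime_two
        · exact Nat.prime_of_mem_primeFactors hp
      intro p hp q hq hpq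
      have hp' := key p hp
      have hq' := key q hq
      have e : (8 : ℕ) = 2 ^ 3 := by norm_num
      have hc := (Nat.coprime_primes hp' hq').2 hpq
      simp only [Function.onFun]
      split_ifs with h1 h2 h2
      · exact absurd (h1.trans h2.symm) hpq
      · rw [e]; subst h1; exact hc.pow_left 3
      · rw [e]; subst h2; exact hc.pow_right 3
      · exact hc)
  refine ⟨d, ?_, ?_⟩
  · have := hd 2 (Finset.mem_insert_self _ _)
    simpa [Nat.ModEq] using this
  · intro p hpP hp hpd hp2 y hy
    by_cases hP : P = 0
    · subst hP
      exact absurd (Nat.le_zero.1 hpP) hp.ne_zero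
    have := hd p (Finset.mem_insert_of_mem (Nat.mem_primeFactors.2 ⟨hp, hpd, hP⟩))
    simp only [hp2, if_false, Nat.ModEq] at this
    rw [this]
    exact ha p hp hp2 y hy

/-- The condition at a single prime: `d` is a nonresidue modulo `p`, or `p = 2` and
`d ≡ 5 [MOD 8]`. -/
theorem InertAt.prime_dvd {P d p : ℕ} (h : InertAt P d) (hP : 0 < P) (hp : p.Prime) (hpP : p ∣ P)
    (hp2 : p ≠ 2) {a b : ℤ} (hab : (p : ℤ) ∣ a ^ 2 - d * b ^ 2) : (p : ℤ) ∣ a ∧ (p : ℤ) ∣ b := by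
  have : Fact p.Prime := ⟨hp⟩
  have hns : ¬ IsSquare (d : ZMod p) := by
    rintro ⟨y, hy⟩
    refine h.2 p (Nat.le_of_dvd hP hpP) hp hpP hp2 y.val y.val_lt ?_
    rw [← ZMod.natCast_eq_natCast_iff']
    push_cast
    rw [ZMod.natCast_zmod_val, hy]
  rw [← ZMod.intCast_zmod_eq_zero_iff_dvd] at hab
  simp only [← ZMod.intCast_zmod_eq_zero_iff_dvd]
  push_cast at hab
  have hb : (b : ZMod p) = 0 := by
    by_contra hb
    refine hns ⟨a / b, ?_⟩
    field_simp
    linear_combination -hab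
  refine ⟨?_, hb⟩
  rw [hb] at hab
  simpa using hab

/-- Values of the norm form of `ℚ(√d)` have even valuation at the inert prime `p`. -/
theorem InertAt.exists_eq_pow_mul {P d p : ℕ} (h : InertAt P d) (hP : 0 < P) (hp : p.Prime)
    (hpP : p ∣ P) (N : ℕ) : ∀ a b : ℤ, a.natAbs + b.natAbs ≤ N → (a ≠ 0 ∨ b ≠ 0) →
    ∃ (k : ℕ) (u : ℤ), a ^ 2 - d * b ^ 2 = p ^ (2 * k) * u ∧ ¬ (p : ℤ) ∣ u ∧ (p : ℤ) ^ k ∣ 2 * a := by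
  induction N with
  | zero =>
    intro a b hN hab
    omega
  | succ N ih =>
    intro a b hN hab
    by_cases hdvd : (p : ℤ) ∣ a ^ 2 - d * b ^ 2
    swap
    · exact ⟨0, _, by simp, hdvd, by simp⟩
    by_cases hboth : (p : ℤ) ∣ a ∧ (p : ℤ) ∣ b
    · obtain ⟨⟨a', rfl⟩, ⟨b', rfl⟩⟩ := hboth
      have hp2 := hp.two_le
      have ha' : (a' ≠ 0 ∨ b' ≠ 0) := by
        by_contra! hc
        simp [hc.1, hc.2] at hab
      have hle : a'.natAbs + b'.natAbs ≤ N := by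
        rw [Int.natAbs_mul, Int.natAbs_mul, Int.natAbs_natCast] at hN
        have h0 : 0 < a'.natAbs + b'.natAbs := by omega
        nlinarith
      obtain ⟨k, u, h1, h2, h3⟩ := ih a' b' hle ha'
      refine ⟨k + 1, u, ?_, h2, ?_⟩
      · linear_combination (p : ℤ) ^ 2 * h1
      · rw [pow_succ', show (2 : ℤ) * (p * a') = p * (2 * a') by ring]
        exact mul_dvd_mul_left _ h3
    · obtain rfl : p = 2 := by
        by_contra hp2
        exact hboth (h.prime_dvd hP hp hpP hp2 hdvd)
      have hd8 := h.1
      obtain ⟨e, he⟩ : ∃ e : ℕ, d = 8 * e + 5 := ⟨d / 8, by omega⟩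
      have hodd : a % 2 = 1 ∧ b % 2 = 1 := by
        have hd : (d : ℤ) = 8 * e + 5 := by exact_mod_cast he
        rw [hd] at hdvd
        rcases Int.emod_two_eq_zero_or_one a with ha | ha <;>
        rcases Int.emod_two_eq_zero_or_one b with hb | hb
        · exact absurd ⟨Int.dvd_of_emod_eq_zero ha, Int.dvd_of_emod_eq_zero hb⟩ hboth
        · exfalso
          obtain ⟨x, rfl⟩ : ∃ x, a = 2 * x := ⟨a / 2, by omega⟩
          obtain ⟨y, rfl⟩ : ∃ y, b = 2 * y + 1 := ⟨b / 2, by omega⟩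
          obtain ⟨t, ht⟩ := hdvd
          ring_nf at ht
          omega
        · exfalso
          obtain ⟨x, rfl⟩ : ∃ x, b = 2 * x := ⟨b / 2, by omega⟩
          obtain ⟨y, rfl⟩ : ∃ y, a = 2 * y + 1 := ⟨a / 2, by omega⟩
          obtain ⟨t, ht⟩ := hdvd
          ring_nf at ht
          omega
        · exact ⟨ha, hb⟩
      obtain ⟨x, rfl⟩ : ∃ x, a = 2 * x + 1 := ⟨a / 2, by omega⟩
      obtain ⟨y, rfl⟩ : ∃ y, b = 2 * y + 1 := ⟨b / 2, by omega⟩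
      obtain ⟨s, hs⟩ := Int.even_mul_succ_self x
      obtain ⟨t, ht⟩ := Int.even_mul_succ_self y
      -- Odd squares are 1 modulo 8 and d ≡ 5, so the value is 4 times an odd number. Here 2 divides
      -- neither coordinate, which is why the divisibility by p ^ k is only claimed for 2a.
      refine ⟨1, 2 * s - 2 * e * (8 * t + 1) - 10 * t - 1, ?_, ?_, ⟨2 * x + 1, by push_cast; ring⟩⟩
      · rw [he]
        push_cast
        linear_combination (4 : ℤ) * hs - 4 * (8 * e + 5) * ht
      · rintro ⟨w, hw⟩
        have : 2 * (s - e * (8 * t + 1) - 5 * t - w) = 1 := by linear_combination hw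
        omega

/-- Parity of valuations: if X² - dV² had p-valuation 2k with k < r, the left side would have
valuation 2k + 1, because p divides P exactly once, whereas the right side is a norm. -/
theorem InertAt.pow_dvd_of_eq {P d p : ℕ} (h : InertAt P d) (hP : Squarefree P) (hp : p.Prime)
    (hpP : p ∣ P) {D X V Y Z : ℤ} (hD : D ^ 2 + P * (X ^ 2 - d * V ^ 2) = Y ^ 2 - d * Z ^ 2) {r : ℕ}
    (hr : (p : ℤ) ^ r ∣ D) : (p : ℤ) ^ r ∣ 2 * X := by
  have hP0 : 0 < P := Nat.pos_of_ne_zero hP.ne_zero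
  by_cases hX : X = 0
  · simp [hX]
  obtain ⟨k, u, h1, h2, h3⟩ := h.exists_eq_pow_mul hP0 hp hpP _ X V le_rfl (Or.inl hX)
  by_cases hkr : r ≤ k
  · exact (pow_dvd_pow _ hkr).trans h3
  exfalso
  have hpi : Prime (p : ℤ) := Nat.prime_iff_prime_int.1 hp
  obtain ⟨P', rfl⟩ := hpP
  have hP' : ¬ (p : ℤ) ∣ P' := by
    intro hd
    have hd' : p ∣ P' := by exact_mod_cast hd
    exact hp.one_lt.ne' (Nat.isUnit_iff.1 (hP p (mul_dvd_mul_left p hd')))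
  obtain ⟨w, hw⟩ := (pow_dvd_pow (p : ℤ) (by omega : k + 1 ≤ r)).trans hr
  have e1 : Y ^ 2 - d * Z ^ 2 = p ^ (2 * k + 1) * (p * w ^ 2 + P' * u) := by
    rw [← hD, hw, h1]; push_cast; ring
  have hnd : ¬ (p : ℤ) ∣ p * w ^ 2 + P' * u := by
    intro hd
    rcases hpi.dvd_or_dvd ((dvd_add_right (dvd_mul_right _ _)).1 hd) with h' | h'
    · exact hP' h'
    · exact h2 h'
  have hYZ : Y ≠ 0 ∨ Z ≠ 0 := by
    by_contra! hc
    rw [hc.1, hc.2] at e1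
    have : (p : ℤ) ^ (2 * k + 1) * (p * w ^ 2 + P' * u) = 0 := by rw [← e1]; ring
    rcases mul_eq_zero.1 this with h' | h'
    · exact hpi.ne_zero (eq_zero_of_pow_eq_zero h')
    · exact hnd (h' ▸ dvd_zero _)
  obtain ⟨k', u', h1', h2', -⟩ := h.exists_eq_pow_mul hP0 hp (dvd_mul_right _ _) _ Y Z le_rfl hYZ
  rw [h1'] at e1
  have hfin : ∀ v : ℤ, ¬ (p : ℤ) ∣ v → ∀ n : ℕ, emultiplicity (p : ℤ) (p ^ n * v) = n := by
    intro v hv n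
    rw [emultiplicity_mul hpi, emultiplicity_pow_self hpi.ne_zero hpi.not_isUnit,
      emultiplicity_eq_zero.2 hv, add_zero]
  have := hfin _ h2' (2 * k')
  rw [e1, hfin _ hnd] at this
  have : 2 * k + 1 = 2 * k' := by exact_mod_cast this
  omega

/-- If p divided the denominator of a, clearing denominators and comparing valuations would give p³
∣ 4, since p divides neither d nor the numerator. The exponent 6, that is the cube of a, is there to
beat this 4 when p = 2. -/
theorem InertAt.coprime_den {P d : ℕ} (h : InertAt P d) (hP : Squarefree P) {a v y z : ℚ}
    (heq : 1 + 4 * P * d ^ 2 * a ^ 6 - P * d * v ^ 2 = y ^ 2 - d * z ^ 2) : a.den.Coprime P := by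
  refine Nat.Coprime.symm (Nat.coprime_of_dvd fun p hp hpP hpa => ?_)
  have hP0 : 0 < P := Nat.pos_of_ne_zero hP.ne_zero
  have hpi : Prime (p : ℤ) := Nat.prime_iff_prime_int.1 hp
  set T : ℤ := v.den * y.den * z.den with hT
  have hT0 : T ≠ 0 := by positivity
  have hpd : ¬ (p : ℤ) ∣ d := by
    intro hd
    by_cases hp2 : p = 2
    · subst hp2
      have := h.1
      have hd' : 2 ∣ d := by exact_mod_cast hd
      omega
    · have := h.prime_dvd hP0 hp hpP hp2 (a := 0) (b := 1) (by simpa using hd)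
      exact hpi.not_dvd_one this.2
  have ha : ¬ (p : ℤ) ∣ a.num := fun hd =>
    hp.one_lt.ne' (Nat.eq_one_of_dvd_coprimes a.reduced (Int.natCast_dvd.1 hd) hpa)
  have hint : (a.den ^ 3 * T) ^ 2 + P * ((2 * d * a.num ^ 3 * T) ^ 2
      - d * (a.den ^ 3 * (v.num * y.den * z.den)) ^ 2)
      = (a.den ^ 3 * (v.den * y.num * z.den)) ^ 2 - d * (a.den ^ 3 * (v.den * y.den * z.num)) ^ 2 := by
    have hq : ∀ q : ℚ, (q.den : ℚ) * q = q.num := fun q => by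
      rw [mul_comm]; exact Rat.mul_den_eq_num q
    have : (((a.den ^ 3 * T) ^ 2 + P * ((2 * d * a.num ^ 3 * T) ^ 2
        - d * (a.den ^ 3 * (v.num * y.den * z.den)) ^ 2) : ℤ) : ℚ)
      = ((a.den ^ 3 * (v.den * y.num * z.den)) ^ 2
        - d * (a.den ^ 3 * (v.den * y.den * z.num)) ^ 2 : ℤ) := by
      rw [hT]
      push_cast
      rw [← hq a, ← hq v, ← hq y, ← hq z]
      linear_combination (a.den ^ 3 * (v.den * y.den * z.den) : ℚ) ^ 2 * heq
    exact_mod_cast this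
  obtain ⟨T', hT', hTT⟩ := (Int.finiteMultiplicity_iff.2
    ⟨by simpa using hp.ne_one, hT0⟩ : FiniteMultiplicity (p : ℤ) T).exists_eq_pow_mul_and_not_dvd
  generalize multiplicity (p : ℤ) T = t at hT'
  have hr : (p : ℤ) ^ (t + 3) ∣ a.den ^ 3 * T := by
    rw [add_comm, pow_add, hT']
    exact mul_dvd_mul (pow_dvd_pow_of_dvd (by exact_mod_cast hpa) 3) (dvd_mul_right _ _)
  have h2X := h.pow_dvd_of_eq hP hp hpP hint hr
  rw [hT', pow_add, show (2 : ℤ) * (2 * d * a.num ^ 3 * (p ^ t * T'))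
    = p ^ t * (4 * (d * a.num ^ 3 * T')) by ring] at h2X
  have h3 : (p : ℤ) ^ 3 ∣ 4 * (d * a.num ^ 3 * T') :=
    (mul_dvd_mul_iff_left (pow_ne_zero _ hpi.ne_zero)).1 h2X
  have hc : IsCoprime ((p : ℤ) ^ 3) (d * a.num ^ 3 * T') := by
    refine IsCoprime.pow_left ?_
    rw [Prime.coprime_iff_not_dvd hpi]
    intro hd
    rcases hpi.dvd_or_dvd hd with hd | hd
    · rcases hpi.dvd_or_dvd hd with hd | hd
      · exact hpd hd
      · exact ha (hpi.dvd_of_dvd_pow hd)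
    · exact hTT hd
  have h4 := Int.le_of_dvd (by norm_num) (hc.dvd_of_dvd_mul_right h3)
  have hp2 : (2 : ℤ) ≤ p := by exact_mod_cast hp.two_le
  have : (2 : ℤ) ^ 3 ≤ p ^ 3 := by gcongr
  linarith

theorem InertAt.exists_of_int {P d : ℕ} (h : InertAt P d) (hP : 0 < P) (a : ℤ) :
    ∃ v y z : ℚ, 1 + 4 * P * d ^ 2 * (a : ℚ) ^ 6 - P * d * v ^ 2 = y ^ 2 - d * z ^ 2 := by
  have hd := h.1
  have hds : ¬ IsSquare d := by
    rintro ⟨r, rfl⟩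
    rw [Nat.mul_mod] at hd
    have : r % 8 < 8 := Nat.mod_lt _ (by norm_num)
    interval_cases r % 8 <;> simp at hd
  -- The form is used with n = 2d|a|³, so that n² = 4d²a⁶.
  obtain ⟨v, y, z, e⟩ := exists_quaternary_form_eq_one hP (by omega) hds
    (dvd_mul_right (2 * d) (a.natAbs ^ 3))
  refine ⟨v, y, z, ?_⟩
  rw [← e]
  have ha : ((a.natAbs : ℕ) : ℚ) ^ 2 = (a : ℚ) ^ 2 := by
    rw [Nat.cast_natAbs, Int.cast_abs, sq_abs]
  push_cast
  linear_combination (-4 * P * d ^ 2 * ((a : ℚ) ^ 4 + a ^ 2 * (a.natAbs : ℚ) ^ 2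
    + (a.natAbs : ℚ) ^ 4)) * ha

/-- A uniform existential definition in `ℚ` of the semilocal ring of those rationals whose
denominators are coprime to `P`. -/
theorem InertAt.coprime_den_iff {P d : ℕ} (h : InertAt P d) (hP : Squarefree P) (x : ℚ) :
    x.den.Coprime P ↔ ∃ a e v y z v' y' z' : ℚ, x * (1 + P * e) = a ∧
      1 + 4 * P * d ^ 2 * a ^ 6 - P * d * v ^ 2 = y ^ 2 - d * z ^ 2 ∧
      1 + 4 * P * d ^ 2 * e ^ 6 - P * d * v' ^ 2 = y' ^ 2 - d * z' ^ 2 := by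
  have hP0 : 0 < P := Nat.pos_of_ne_zero hP.ne_zero
  constructor
  · intro hx
    -- Bézout: m · den x = 1 - nP, so integers a = m · num x and e = -n satisfy x(1 + Pe) = a.
    obtain ⟨m, n, hmn⟩ := Nat.isCoprime_iff_coprime.2 hx
    obtain ⟨v, y, z, e1⟩ := h.exists_of_int hP0 (x.num * m)
    obtain ⟨v', y', z', e2⟩ := h.exists_of_int hP0 (-n)
    refine ⟨_, _, v, y, z, v', y', z', ?_, e1, e2⟩
    have hmn' : (m : ℚ) * x.den + n * P = 1 := by exact_mod_cast hmn
    push_cast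
    have := Rat.mul_den_eq_num x
    rw [← this]
    linear_combination (-x) * hmn'
  · rintro ⟨a, e, v, y, z, v', y', z', e0, e1, e2⟩
    have ha := h.coprime_den hP e1
    have he := h.coprime_den hP e2
    refine Nat.Coprime.symm (Nat.coprime_of_dvd fun p hp hpP hpx => ?_)
    have hpi : Prime (p : ℤ) := Nat.prime_iff_prime_int.1 hp
    -- Modulo p the factor `e.den + P * e.num` is just `e.den`, a unit; hence x has no p in its
    -- denominator.
    have hint : x.num * a.den * (e.den + P * e.num) = a.num * x.den * e.den := by
      have hq : ∀ q : ℚ, (q.den : ℚ) * q = q.num := fun q => by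
        rw [mul_comm]; exact Rat.mul_den_eq_num q
      have : (x.num * a.den * (e.den + P * e.num) : ℚ) = a.num * x.den * e.den := by
        rw [← hq a, ← hq e, ← hq x]
        linear_combination (x.den * a.den * e.den : ℚ) * e0
      exact_mod_cast this
    have hd : (p : ℤ) ∣ x.num * a.den * (e.den + P * e.num) := by
      rw [hint]
      exact ((Int.natCast_dvd_natCast.2 hpx).mul_left _).mul_right _
    have hnot : ∀ q : ℚ, q.den.Coprime P → ¬ (p : ℤ) ∣ q.den := fun q hq hd =>
      hp.one_lt.ne' (Nat.eq_one_of_dvd_coprimes hq (Int.natCast_dvd_natCast.1 hd) hpP)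
    rcases hpi.dvd_or_dvd hd with hd | hd
    · rcases hpi.dvd_or_dvd hd with hd | hd
      · exact hp.one_lt.ne' (Nat.eq_one_of_dvd_coprimes x.reduced (Int.natCast_dvd.1 hd) hpx)
      · exact hnot a ha hd
    · refine hnot e he ((Int.dvd_add_left ?_).1 hd)
      exact (Int.natCast_dvd_natCast.2 hpP).mul_right _

/-! ### Polynomials as lists of terms -/

/-- Finite lists of terms, representing polynomials as in `polyOfTerms`. -/
abbrev TermList := List (ℤ × List ℕ)

/-- The value at a rational point of the monomial with a given list of exponents. -/
noncomputable def expVal (x : ℕ → ℚ) (l : List ℕ) : ℚ :=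
  l.toFinsupp.prod fun i k => x i ^ k

/-- The value of a single term at a rational point. -/
noncomputable def termVal (x : ℕ → ℚ) (t : ℤ × List ℕ) : ℚ :=
  t.1 * expVal x t.2

/-- The value at a rational point of the polynomial given by a list of terms. -/
noncomputable def evalTerms (x : ℕ → ℚ) (L : TermList) : ℚ :=
  (L.map (termVal x)).sum

theorem aeval_polyOfTerms (x : ℕ → ℚ) (L : TermList) :
    MvPolynomial.aeval x (polyOfTerms L) = evalTerms x L := by
  simp only [polyOfTerms, evalTerms, map_list_sum, List.map_map]
  congr 2
  funext t
  simp [termVal, expVal, MvPolynomial.aeval_monomial]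

theorem mem_HTP_subring_iff (R : Subring ℚ) (e : ℕ) :
    e ∈ HTP R ↔ ∃ x : ℕ → ℚ, (∀ i, x i ∈ R) ∧
      evalTerms x (Denumerable.ofNat TermList e) = 0 := by
  have key : ∀ y : ℕ → R, ((MvPolynomial.aeval y (polyEnum e) : R) : ℚ)
      = evalTerms (fun i => y i) (Denumerable.ofNat TermList e) := by
    intro y
    rw [← aeval_polyOfTerms]
    have := MvPolynomial.map_aeval (R := ℤ) y R.subtype (polyEnum e)
    rw [← Subring.subtype_apply, this, MvPolynomial.aeval_def, polyEnum]
    congr 1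
  constructor
  · rintro ⟨y, hy⟩
    refine ⟨fun i => y i, fun i => (y i).2, ?_⟩
    rw [← key, hy]; rfl
  · rintro ⟨x, hx, h⟩
    refine ⟨fun i => ⟨x i, hx i⟩, ?_⟩
    have := key (fun i => ⟨x i, hx i⟩)
    rw [h] at this
    exact_mod_cast this

theorem mem_HTP_rat_iff (e : ℕ) :
    e ∈ HTP ℚ ↔ ∃ x : ℕ → ℚ, evalTerms x (Denumerable.ofNat TermList e) = 0 := by
  simp only [← aeval_polyOfTerms]
  rfl

@[simp] theorem evalTerms_nil (x : ℕ → ℚ) : evalTerms x [] = 0 := rfl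

@[simp] theorem evalTerms_cons (x : ℕ → ℚ) (t : ℤ × List ℕ) (L : TermList) :
    evalTerms x (t :: L) = termVal x t + evalTerms x L := by
  simp [evalTerms]

@[simp] theorem evalTerms_append (x : ℕ → ℚ) (L M : TermList) :
    evalTerms x (L ++ M) = evalTerms x L + evalTerms x M := by
  simp [evalTerms]

/-- Sum of exponent lists. -/
def addExp (a b : List ℕ) : List ℕ :=
  (List.range (a.length + b.length)).map fun i => a.getD i 0 + b.getD i 0

theorem getD_addExp (a b : List ℕ) (i : ℕ) :
    (addExp a b).getD i 0 = a.getD i 0 + b.getD i 0 := by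
  simp only [addExp, List.getD_eq_getElem?_getD]
  by_cases h : i < a.length + b.length
  · simp [h]
  · rw [List.getElem?_eq_none (by simpa using h), List.getElem?_eq_none (by omega),
      List.getElem?_eq_none (by omega)]
    rfl

theorem expVal_addExp (x : ℕ → ℚ) (a b : List ℕ) :
    expVal x (addExp a b) = expVal x a * expVal x b := by
  have h : (addExp a b).toFinsupp = a.toFinsupp + b.toFinsupp := by
    ext i
    rw [Finsupp.add_apply, List.toFinsupp_apply, List.toFinsupp_apply, List.toFinsupp_apply,
      getD_addExp]
  rw [expVal, h, Finsupp.prod_add_index' (by simp) (by simp [pow_add])]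
  rfl

/-- Product of terms. -/
def mulTerm (s t : ℤ × List ℕ) : ℤ × List ℕ :=
  (s.1 * t.1, addExp s.2 t.2)

@[simp] theorem termVal_mulTerm (x : ℕ → ℚ) (s t : ℤ × List ℕ) :
    termVal x (mulTerm s t) = termVal x s * termVal x t := by
  simp only [termVal, mulTerm, expVal_addExp]
  push_cast
  ring

/-- The exponent list of `X k ^ e`. -/
def monoExp (k e : ℕ) : List ℕ :=
  (List.range k).map (fun _ => 0) ++ [e]

theorem getD_monoExp (k e i : ℕ) : (monoExp k e).getD i 0 = if k = i then e else 0 := by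
  simp only [monoExp, List.getD_eq_getElem?_getD]
  rcases lt_trichotomy i k with h | h | h
  · rw [List.getElem?_append_left (by simpa using h)]
    simp [h, h.ne']
  · subst h
    rw [List.getElem?_append_right (by simp)]
    simp
  · rw [List.getElem?_eq_none (by simp; omega)]
    simp [h.ne]

@[simp] theorem termVal_monoExp (x : ℕ → ℚ) (c : ℤ) (k e : ℕ) :
    termVal x (c, monoExp k e) = c * x k ^ e := by
  have h : (monoExp k e).toFinsupp = Finsupp.single k e := by
    ext i
    rw [List.toFinsupp_apply, getD_monoExp, Finsupp.single_apply]
  simp [termVal, expVal, h]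

@[simp] theorem termVal_const (x : ℕ → ℚ) (c : ℤ) : termVal x (c, []) = c := by
  simp [termVal, expVal]

theorem termVal_congr {x y : ℕ → ℚ} {t : ℤ × List ℕ} (h : ∀ i < t.2.length, x i = y i) :
    termVal x t = termVal y t := by
  unfold termVal expVal
  congr 1
  refine Finsupp.prod_congr fun i hi => ?_
  rw [h i]
  rw [List.toFinsupp_support, Finset.mem_filter, Finset.mem_range] at hi
  exact hi.1

theorem termVal_smul (x : ℕ → ℚ) (y : ℚ) (t : ℤ × List ℕ) :
    termVal (fun i => y * x i) t = y ^ t.2.sum * termVal x t := by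
  have hsum : t.2.toFinsupp.sum (fun _ k => k) = t.2.sum := by
    rw [Finsupp.sum_of_support_subset _ (s := Finset.range t.2.length) (by
      rw [List.toFinsupp_support]; exact Finset.filter_subset _ _) _ (by simp), Finset.sum_range]
    simp [List.toFinsupp_apply]
  simp only [termVal, expVal, mul_pow, Finsupp.prod_mul]
  rw [← hsum, Finsupp.sum, ← Finset.prod_pow_eq_pow_sum, Finsupp.prod]
  ring

/-- A bound for the number of variables. -/
def numVars (L : TermList) : ℕ :=
  (L.flatMap Prod.snd).length

theorem length_le_numVars {L : TermList} {t : ℤ × List ℕ} (h : t ∈ L) :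
    t.2.length ≤ numVars L := by
  induction L with
  | nil => simp at h
  | cons s L ih =>
    simp only [numVars, List.flatMap_cons, List.length_append] at ih ⊢
    rcases List.mem_cons.1 h with rfl | h
    · omega
    · have := ih h; omega

theorem evalTerms_congr {x y : ℕ → ℚ} {L : TermList} (h : ∀ i < numVars L, x i = y i) :
    evalTerms x L = evalTerms y L := by
  unfold evalTerms
  congr 1
  exact List.map_congr_left fun t ht =>
    termVal_congr fun i hi => h i (hi.trans_le (length_le_numVars ht))

/-- A bound for the total degree. -/
def degBound (L : TermList) : ℕ :=
  (L.flatMap Prod.snd).sum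

theorem sum_le_degBound {L : TermList} {t : ℤ × List ℕ} (h : t ∈ L) : t.2.sum ≤ degBound L := by
  induction L with
  | nil => simp at h
  | cons s L ih =>
    simp only [degBound, List.flatMap_cons, List.sum_append] at ih ⊢
    rcases List.mem_cons.1 h with rfl | h
    · omega
    · have := ih h; omega

/-- Homogenization in degree `degBound L`, by means of the variable `X (numVars L)`. -/
def homogenize (L : TermList) : TermList :=
  L.map fun t => mulTerm t (1, monoExp (numVars L) (degBound L - t.2.sum))

theorem evalTerms_homogenize {x : ℕ → ℚ} {L : TermList} (h : x (numVars L) ≠ 0) :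
    evalTerms x (homogenize L)
      = x (numVars L) ^ degBound L * evalTerms (fun i => (x (numVars L))⁻¹ * x i) L := by
  simp only [evalTerms, homogenize, List.map_map, ← List.sum_map_mul_left]
  congr 1
  refine List.map_congr_left fun t ht => ?_
  simp only [Function.comp, termVal_mulTerm, termVal_monoExp, termVal_smul]
  rw [pow_sub₀ _ h (sum_le_degBound ht)]
  push_cast
  rw [inv_pow]
  ring

/-- Product of polynomials. -/
def mulTerms (L M : TermList) : TermList :=
  L.flatMap fun s => M.map (mulTerm s)

@[simp] theorem evalTerms_mulTerms (x : ℕ → ℚ) (L M : TermList) :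
    evalTerms x (mulTerms L M) = evalTerms x L * evalTerms x M := by
  induction L with
  | nil => simp [mulTerms]
  | cons s L ih =>
    simp only [mulTerms, List.flatMap_cons, evalTerms_append, evalTerms_cons] at ih ⊢
    rw [ih, add_mul]
    congr 1
    simp only [evalTerms, List.map_map, ← List.sum_map_mul_left]
    congr 1
    refine List.map_congr_left fun t _ => ?_
    simp

/-- The sum of the squares, whose zeros are the common zeros. -/
def sumSq (Ls : List TermList) : TermList :=
  Ls.flatMap fun L => mulTerms L L

theorem evalTerms_sumSq (x : ℕ → ℚ) (Ls : List TermList) :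
    evalTerms x (sumSq Ls) = 0 ↔ ∀ L ∈ Ls, evalTerms x L = 0 := by
  have hnn : ∀ Ls, 0 ≤ evalTerms x (sumSq Ls) := by
    intro Ls
    induction Ls with
    | nil => simp [sumSq]
    | cons L Ls ih =>
      simp only [sumSq, List.flatMap_cons, evalTerms_append, evalTerms_mulTerms] at ih ⊢
      have := mul_self_nonneg (evalTerms x L)
      linarith
  induction Ls with
  | nil => simp [sumSq]
  | cons L Ls ih =>
    rw [List.forall_mem_cons]
    refine Iff.trans ?_ (and_congr Iff.rfl ih)
    have h1 := hnn Ls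
    have h2 := mul_self_nonneg (evalTerms x L)
    simp only [sumSq, List.flatMap_cons, evalTerms_append, evalTerms_mulTerms] at h1 h2 ⊢
    rw [add_eq_zero_iff_of_nonneg h2 h1, mul_self_eq_zero]

/-! ### Reductions between Diophantine problems -/

/-- The polynomial `1 + 4 P d² X_k⁶ - P d X_l² - X_{l+1}² + d X_{l+2}²`. -/
def normEq (P d k l : ℕ) : TermList :=
  [(1, []), (((4 * P * d ^ 2 : ℕ) : ℤ), monoExp k 6), (-((P * d : ℕ) : ℤ), monoExp l 2),
    (-1, monoExp (l + 1) 2), ((d : ℤ), monoExp (l + 2) 2)]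

/-- The polynomial `X_i + P X_i X_{k+1} - X_k`. -/
def linkEq (P i k : ℕ) : TermList :=
  [(1, monoExp i 1), mulTerm ((P : ℤ), monoExp i 1) (1, monoExp (k + 1) 1), (-1, monoExp k 1)]

/-- Equations which express that the first `N` coordinates have denominators coprime to `P`; the
other variables are auxiliary. -/
def semilocalEqs (N P d : ℕ) : List TermList :=
  (List.range N).flatMap fun i => [linkEq P i (N + 8 * i), normEq P d (N + 8 * i) (N + 8 * i + 2),
    normEq P d (N + 8 * i + 1) (N + 8 * i + 5)]

/-- A polynomial which has a rational zero iff `L` has a zero with denominators coprime to `P`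
that satisfies the further equations `Es`. -/
def semilocalQuery (L : TermList) (P d : ℕ) (Es : List TermList) : TermList :=
  sumSq (L :: (semilocalEqs (numVars L) P d ++ Es))

theorem evalTerms_normEq (x : ℕ → ℚ) (P d k l : ℕ) :
    evalTerms x (normEq P d k l) = 0 ↔
      1 + 4 * P * d ^ 2 * x k ^ 6 - P * d * x l ^ 2 = x (l + 1) ^ 2 - d * x (l + 2) ^ 2 := by
  simp only [normEq, evalTerms_cons, evalTerms_nil, termVal_const, termVal_monoExp]
  push_cast
  constructor <;> intro h <;> linear_combination h

theorem evalTerms_linkEq (x : ℕ → ℚ) (P i k : ℕ) :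
    evalTerms x (linkEq P i k) = 0 ↔ x i * (1 + P * x (k + 1)) = x k := by
  simp only [linkEq, evalTerms_cons, evalTerms_nil, termVal_monoExp, termVal_mulTerm]
  push_cast
  constructor <;> intro h <;> linear_combination h

/-- Each of the first N coordinates has its own eight auxiliary variables, witnessing that its
denominator is coprime to P. Since L and `Es` see only the first N variables, the others can be
reassigned freely. -/
theorem exists_zero_semilocalQuery_iff {L : TermList} {P d : ℕ} (h : InertAt P d)
    (hP : Squarefree P) {Es : List TermList} (hEs : ∀ M ∈ Es, ∀ x y : ℕ → ℚ,
      (∀ i < numVars L, x i = y i) → evalTerms x M = evalTerms y M) :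
    (∃ x, evalTerms x (semilocalQuery L P d Es) = 0) ↔
      ∃ x, (∀ i < numVars L, (x i).den.Coprime P) ∧ evalTerms x L = 0 ∧
        ∀ M ∈ Es, evalTerms x M = 0 := by
  set N := numVars L with hN
  have key : ∀ x : ℕ → ℚ, (∀ M ∈ semilocalEqs N P d, evalTerms x M = 0) ↔
      ∀ i < N, evalTerms x (linkEq P i (N + 8 * i)) = 0 ∧
        evalTerms x (normEq P d (N + 8 * i) (N + 8 * i + 2)) = 0 ∧
        evalTerms x (normEq P d (N + 8 * i + 1) (N + 8 * i + 5)) = 0 := by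
    intro x
    simp only [semilocalEqs, List.mem_flatMap, List.mem_range, List.mem_cons, List.not_mem_nil,
      or_false]
    constructor
    · intro H i hi
      exact ⟨H _ ⟨i, hi, Or.inl rfl⟩, H _ ⟨i, hi, Or.inr (Or.inl rfl)⟩,
        H _ ⟨i, hi, Or.inr (Or.inr rfl)⟩⟩
    · rintro H M ⟨i, hi, rfl | rfl | rfl⟩
      exacts [(H i hi).1, (H i hi).2.1, (H i hi).2.2]
  simp only [semilocalQuery, evalTerms_sumSq, List.forall_mem_cons, List.forall_mem_append, ← hN,
    key, evalTerms_normEq, evalTerms_linkEq]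
  constructor
  · rintro ⟨x, hx, hloc, hE⟩
    refine ⟨x, fun i hi => (h.coprime_den_iff hP _).2 ?_, hx, hE⟩
    obtain ⟨h1, h2, h3⟩ := hloc i hi
    exact ⟨_, _, _, _, _, _, _, _, h1, h2, h3⟩
  · rintro ⟨x, hx, hL, hE⟩
    choose! a e v y z v' y' z' H using fun i hi => (h.coprime_den_iff hP (x i)).1 (hx i hi)
    let aux : ℕ → ℕ → ℚ := fun i k => match k with
      | 0 => a i | 1 => e i | 2 => v i | 3 => y i | 4 => z i | 5 => v' i | 6 => y' i | _ => z' i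
    -- Block i occupies the indices N + 8i to N + 8i + 7, in the order a, e, v, y, z, v', y', z'.
    let X : ℕ → ℚ := fun m => if m < N then x m else aux ((m - N) / 8) ((m - N) % 8)
    have hX : ∀ i < N, X i = x i := fun i hi => if_pos hi
    have hXa : ∀ i k, k < 8 → X (N + 8 * i + k) = aux i k := by
      intro i k hk
      have h1 : ¬ N + 8 * i + k < N := by omega
      have h2 : (N + 8 * i + k - N) / 8 = i := by omega
      have h3 : (N + 8 * i + k - N) % 8 = k := by omega
      simp only [X, h1, if_false, h2, h3]
    refine ⟨X, ?_, ?_, ?_⟩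
    · rw [evalTerms_congr hX, hL]
    · intro i hi
      obtain ⟨h1, h2, h3⟩ := H i hi
      have e0 := hXa i 0 (by norm_num)
      rw [add_zero] at e0
      rw [e0, hX i hi, hXa i 1 (by norm_num), hXa i 2 (by norm_num), hXa i 5 (by norm_num)]
      simp only [add_assoc, Nat.reduceAdd]
      simp only [← add_assoc]
      rw [hXa i 3 (by norm_num), hXa i 4 (by norm_num), hXa i 6 (by norm_num),
        hXa i 7 (by norm_num)]
      exact ⟨h1, h2, h3⟩
    · intro M hM
      rw [hEs M hM X x hX, hE M hM]

/-- The polynomial `X_N² X_{N+1}² - 1 - X_{N+2}² - X_{N+3}² - X_{N+4}² - X_{N+5}²`. -/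
def nonzeroEq (N : ℕ) : TermList :=
  [mulTerm (1, monoExp N 2) (1, monoExp (N + 1) 2), (-1, []), (-1, monoExp (N + 2) 2),
    (-1, monoExp (N + 3) 2), (-1, monoExp (N + 4) 2), (-1, monoExp (N + 5) 2)]

theorem evalTerms_nonzeroEq (x : ℕ → ℚ) (N : ℕ) :
    evalTerms x (nonzeroEq N) = 0 ↔ (x N * x (N + 1)) ^ 2 =
      1 + x (N + 2) ^ 2 + x (N + 3) ^ 2 + x (N + 4) ^ 2 + x (N + 5) ^ 2 := by
  simp only [nonzeroEq, evalTerms_cons, evalTerms_nil, termVal_const, termVal_monoExp,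
    termVal_mulTerm]
  push_cast
  constructor <;> intro h <;> linear_combination h

/-- A polynomial which has a zero in a given subring of `ℚ` iff `L` has a rational zero. -/
def homQuery (L : TermList) : TermList :=
  sumSq [homogenize L, nonzeroEq (numVars L)]

theorem exists_common_den (x : ℕ → ℚ) (N : ℕ) :
    ∃ b : ℕ, 0 < b ∧ ∀ i < N, ∃ a : ℤ, (b : ℚ) * x i = a := by
  refine ⟨∏ i ∈ Finset.range N, (x i).den, Finset.prod_pos fun i _ => (x i).pos, fun i hi => ?_⟩
  obtain ⟨c, hc⟩ := Finset.dvd_prod_of_mem (fun i => (x i).den) (Finset.mem_range.2 hi)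
  refine ⟨c * (x i).num, ?_⟩
  rw [hc]
  push_cast
  rw [← Rat.mul_den_eq_num]
  ring

/-- A rational zero is an integral zero of the homogenization with nonzero last coordinate. The
second equation forces that coordinate to be nonzero, and Lagrange's theorem solves it in ℤ, hence
in every R. -/
theorem exists_zero_homQuery_iff (R : Subring ℚ) (L : TermList) :
    (∃ x : ℕ → ℚ, (∀ i, x i ∈ R) ∧ evalTerms x (homQuery L) = 0) ↔
      ∃ x : ℕ → ℚ, evalTerms x L = 0 := by
  set N := numVars L with hN
  simp only [homQuery, evalTerms_sumSq, List.forall_mem_cons, List.not_mem_nil,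
    false_imp_iff, implies_true, and_true, ← hN, evalTerms_nonzeroEq]
  constructor
  · rintro ⟨x, -, h1, h2⟩
    have h0 : x N ≠ 0 := by
      intro h0
      rw [h0] at h2
      have : (0 : ℚ) < 1 + x (N + 2) ^ 2 + x (N + 3) ^ 2 + x (N + 4) ^ 2 + x (N + 5) ^ 2 := by
        positivity
      simp [← h2] at this
    rw [evalTerms_homogenize h0] at h1
    exact ⟨_, (mul_eq_zero.1 h1).resolve_left (pow_ne_zero _ h0)⟩
  · rintro ⟨x, hx⟩
    obtain ⟨b, hb, hbx⟩ := exists_common_den x N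
    obtain ⟨p, q, r, s, hs⟩ := Nat.sum_four_squares (b ^ 2 - 1)
    -- The last homogeneous coordinate is a common denominator b, its cofactor is 1, and b² - 1 is
    -- the sum of four squares.
    let y : ℕ → ℚ := fun m => if m < N then b * x m else if m = N then b else
      if m = N + 1 then 1 else if m = N + 2 then p else if m = N + 3 then q else
      if m = N + 4 then r else if m = N + 5 then s else 0
    have yN : y N = b := by simp [y]
    refine ⟨y, ?_, ?_, ?_⟩
    · intro i
      simp only [y]
      split_ifs with hi
      · obtain ⟨a, ha⟩ := hbx i hi
        rw [ha]
        exact intCast_mem R a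
      all_goals exact natCast_mem R _
    · have hb' : (b : ℚ) ≠ 0 := by exact_mod_cast hb.ne'
      rw [evalTerms_homogenize (by rw [← hN, yN]; exact hb'), ← hN, yN,
        evalTerms_congr (y := x) fun i hi => ?_, hx, mul_zero]
      simp only [y, hN, hi, if_true]
      field_simp
    · have hb2 : 1 ≤ b ^ 2 := Nat.one_le_pow _ _ hb
      have hs' : (b ^ 2 : ℚ) = 1 + p ^ 2 + q ^ 2 + r ^ 2 + s ^ 2 := by
        have : b ^ 2 = 1 + p ^ 2 + q ^ 2 + r ^ 2 + s ^ 2 := by omega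
        exact_mod_cast this
      simp [y, hs']

/-! ### Primitive recursiveness of the reductions -/

namespace Primrec

/-- The code of an integer n ≥ 0 is 2n, and that of -(n + 1) is 2n + 1; the arithmetic of ℤ below is
read off from these codes. -/
theorem int_natCast : Primrec (fun n : ℕ => (n : ℤ)) :=
  encode_iff.1 (nat_double.of_eq fun _ => rfl)

theorem int_natAbs : Primrec Int.natAbs := by
  refine ((nat_div2.comp (succ.comp Primrec.encode)).of_eq fun z => ?_ :
    Primrec fun z : ℤ => z.natAbs)
  cases z with
  | ofNat n =>
    have : Encodable.encode (Int.ofNat n) = 2 * n := rfl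
    rw [this, Nat.div2_val]
    show (2 * n + 1) / 2 = n
    omega
  | negSucc n =>
    have : Encodable.encode (Int.negSucc n) = 2 * n + 1 := rfl
    rw [this, Nat.div2_val, Int.natAbs_negSucc]; omega

theorem int_isNeg : Primrec (fun z : ℤ => decide (z < 0)) := by
  refine (nat_bodd.comp Primrec.encode).of_eq fun z => ?_
  cases z with
  | ofNat n =>
    have : Encodable.encode (Int.ofNat n) = 2 * n := rfl
    rw [this]; simp
  | negSucc n =>
    have : Encodable.encode (Int.negSucc n) = 2 * n + 1 := rfl
    rw [this]; simp [Int.negSucc_lt_zero]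

theorem int_neg_natCast : Primrec (fun n : ℕ => -(n : ℤ)) := by
  -- The code is 2n - 1; truncated subtraction makes it right at n = 0 too.
  refine encode_iff.1 ((nat_sub.comp nat_double (const 1)).of_eq fun n => ?_)
  cases n with
  | zero => rfl
  | succ n => exact (show 2 * n + 1 = Encodable.encode (Int.negSucc n) from rfl)

theorem int_mul : Primrec₂ ((· * ·) : ℤ → ℤ → ℤ) := by
  have habs : Primrec₂ fun a b : ℤ => a.natAbs * b.natAbs :=
    nat_mul.comp₂ (int_natAbs.comp₂ .left) (int_natAbs.comp₂ .right)
  refine (Primrec.ite (c := fun p : ℤ × ℤ => decide (p.1 < 0) = decide (p.2 < 0))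
    (Primrec.eq.comp (int_isNeg.comp fst) (int_isNeg.comp snd))
    (int_natCast.comp habs) (int_neg_natCast.comp habs)).of_eq fun ⟨a, b⟩ => ?_
  simp only [decide_eq_decide]
  push_cast
  rcases lt_or_ge a 0 with ha | ha <;> rcases lt_or_ge b 0 with hb | hb
  · simp [ha, hb, abs_of_neg]
  · simp [ha, hb.not_gt, abs_of_neg ha, abs_of_nonneg hb]
  · simp [ha.not_gt, hb, abs_of_nonneg ha, abs_of_neg hb]
  · simp [ha.not_gt, hb.not_gt, abs_of_nonneg ha, abs_of_nonneg hb]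

theorem nat_pow : Primrec₂ ((· ^ ·) : ℕ → ℕ → ℕ) :=
  Primrec₂.unpaired'.1 Nat.Primrec.pow

theorem list_sum : Primrec (List.sum : List ℕ → ℕ) :=
  list_foldr Primrec.id (const 0) (nat_add.comp (fst.comp snd) (snd.comp snd)).to₂

theorem list_prod : Primrec (List.prod : List ℕ → ℕ) :=
  list_foldr Primrec.id (const 1) (nat_mul.comp (fst.comp snd) (snd.comp snd)).to₂

theorem list_replicate {α : Type*} [Primcodable α] :
    Primrec₂ (List.replicate : ℕ → α → List α) :=
  (list_map (list_range.comp fst) (snd.comp fst).to₂).of_eq fun p => by simp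

end Primrec

open Primrec

theorem PrimrecRel.nat_dvd : PrimrecRel ((· ∣ ·) : ℕ → ℕ → Prop) :=
  (Primrec.eq.comp (nat_mod.comp snd fst) (const 0)).of_eq fun _ =>
    (Nat.dvd_iff_mod_eq_zero ..).symm

theorem PrimrecPred.nat_prime : PrimrecPred Nat.Prime := by
  have hR : PrimrecRel fun m p : ℕ => ¬ m ∣ p ∨ m = 1 :=
    (PrimrecRel.nat_dvd.not).or (Primrec.eq.comp fst (const 1))
  refine ((nat_le.comp (const 2) Primrec.id).and (hR.forall_lt.comp Primrec.id Primrec.id)).of_eq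
    fun p => ?_
  rw [Nat.prime_def_lt]
  simp only [id, imp_iff_not_or]

/-- The bounds p ≤ P and y < p in `InertAt` keep every quantifier bounded. -/
theorem primrecRel_inertAt : PrimrecRel InertAt := by
  have h1 : PrimrecRel fun (y : ℕ) (q : ℕ × ℕ) => (y * y) % q.1 ≠ q.2 % q.1 :=
    (Primrec.eq.comp (nat_mod.comp (nat_mul.comp fst fst) (fst.comp snd))
      (nat_mod.comp (snd.comp snd) (fst.comp snd))).not
  have h2 : PrimrecRel fun (p : ℕ) (q : ℕ × ℕ) =>
      ¬ p.Prime ∨ ¬ p ∣ q.1 ∨ p = 2 ∨ ∀ y ∈ List.range p, (y * y) % p ≠ q.2 % p :=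
    (PrimrecPred.nat_prime.comp fst).not.or ((PrimrecRel.nat_dvd.comp fst (fst.comp snd)).not.or
      ((Primrec.eq.comp fst (const 2)).or
        (h1.forall_mem_list.comp (list_range.comp fst) (pair fst (snd.comp snd)))))
  refine ((Primrec.eq.comp (nat_mod.comp snd (const 8)) (const 5)).and
    (h2.forall_mem_list.comp (list_range.comp (succ.comp fst)) Primrec.id)).of_eq fun q => ?_
  refine and_congr Iff.rfl (forall_congr' fun p => ?_)
  simp only [List.mem_range, Nat.succ_eq_add_one, Nat.lt_succ_iff, id]
  tauto

theorem primrec_addExp : Primrec₂ addExp :=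
  list_map (list_range.comp (nat_add.comp (list_length.comp fst) (list_length.comp snd)))
    (nat_add.comp ((list_getD 0).comp (fst.comp fst) snd)
      ((list_getD 0).comp (snd.comp fst) snd)).to₂

theorem primrec_mulTerm : Primrec₂ mulTerm :=
  pair (int_mul.comp (fst.comp fst) (fst.comp snd)) (primrec_addExp.comp (snd.comp fst)
    (snd.comp snd))

theorem primrec_monoExp : Primrec₂ monoExp :=
  list_append.comp (list_map (list_range.comp fst) (const 0).to₂)
    (list_cons.comp snd (const []))

theorem primrec_numVars : Primrec numVars :=
  list_length.comp (list_flatMap Primrec.id (snd.comp snd).to₂)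

theorem primrec_degBound : Primrec degBound :=
  Primrec.list_sum.comp (list_flatMap Primrec.id (snd.comp snd).to₂)

theorem primrec_homogenize : Primrec homogenize :=
  list_map Primrec.id (primrec_mulTerm.comp snd (pair (const 1) (primrec_monoExp.comp
    (primrec_numVars.comp fst) (nat_sub.comp (primrec_degBound.comp fst)
      (Primrec.list_sum.comp (snd.comp snd)))))).to₂

theorem primrec_mulTerms : Primrec₂ mulTerms :=
  list_flatMap fst (list_map (snd.comp fst) (primrec_mulTerm.comp (snd.comp fst) snd).to₂).to₂

theorem primrec_sumSq : Primrec sumSq :=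
  list_flatMap Primrec.id (primrec_mulTerms.comp snd snd).to₂

section

variable {α : Type*} [Primcodable α]

theorem Primrec.list_two {β : Type*} [Primcodable β] {f g : α → β} (hf : Primrec f)
    (hg : Primrec g) : Primrec fun a => [f a, g a] :=
  list_cons.comp hf (list_cons.comp hg (const []))

theorem Primrec.list_three {β : Type*} [Primcodable β] {f g h : α → β} (hf : Primrec f)
    (hg : Primrec g) (hh : Primrec h) : Primrec fun a => [f a, g a, h a] :=
  list_cons.comp hf (list_two hg hh)

theorem Primrec.monomial {c : α → ℤ} {k : α → ℕ} (hc : Primrec c) (hk : Primrec k) (e : ℕ) :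
    Primrec fun a => ((c a, monoExp (k a) e) : ℤ × List ℕ) :=
  pair hc (primrec_monoExp.comp hk (const e))

theorem Primrec.nat_add_const {k : α → ℕ} (hk : Primrec k) (n : ℕ) :
    Primrec fun a => k a + n :=
  nat_add.comp hk (const n)

theorem primrec_normEq {P d k l : α → ℕ} (hP : Primrec P) (hd : Primrec d) (hk : Primrec k)
    (hl : Primrec l) : Primrec fun a => normEq (P a) (d a) (k a) (l a) :=
  list_cons.comp (const (1, [])) <| list_cons.comp (Primrec.monomial (int_natCast.comp
      (nat_mul.comp (nat_mul.comp (const 4) hP) (nat_pow.comp hd (const 2)))) hk 6) <|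
    list_three (Primrec.monomial (int_neg_natCast.comp (nat_mul.comp hP hd)) hl 2)
      (Primrec.monomial (const (-1)) (nat_add_const hl 1) 2)
      (Primrec.monomial (int_natCast.comp hd) (nat_add_const hl 2) 2)

theorem primrec_linkEq {P i k : α → ℕ} (hP : Primrec P) (hi : Primrec i) (hk : Primrec k) :
    Primrec fun a => linkEq (P a) (i a) (k a) :=
  list_three (Primrec.monomial (const 1) hi 1)
    (primrec_mulTerm.comp (Primrec.monomial (int_natCast.comp hP) hi 1)
      (Primrec.monomial (const 1) (nat_add_const hk 1) 1))
    (Primrec.monomial (const (-1)) hk 1)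

theorem primrec_semilocalEqs {N P d : α → ℕ} (hN : Primrec N) (hP : Primrec P) (hd : Primrec d) :
    Primrec fun a => semilocalEqs (N a) (P a) (d a) := by
  have hk : Primrec fun q : α × ℕ => N q.1 + 8 * q.2 :=
    nat_add.comp (hN.comp fst) (nat_mul.comp (const 8) snd)
  exact list_flatMap (list_range.comp hN) (list_three
    (primrec_linkEq (hP.comp fst) snd hk)
    (primrec_normEq (hP.comp fst) (hd.comp fst) hk (nat_add_const hk 2))
    (primrec_normEq (hP.comp fst) (hd.comp fst) (nat_add_const hk 1) (nat_add_const hk 5))).to₂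

theorem primrec_semilocalQuery {L : α → TermList} {P d : α → ℕ} {Es : α → List TermList}
    (hL : Primrec L) (hP : Primrec P) (hd : Primrec d) (hE : Primrec Es) :
    Primrec fun a => semilocalQuery (L a) (P a) (d a) (Es a) :=
  primrec_sumSq.comp (list_cons.comp hL (list_append.comp
    (primrec_semilocalEqs (primrec_numVars.comp hL) hP hd) hE))

end

theorem primrec_homQuery : Primrec homQuery := by
  have h : ∀ n, Primrec fun L : TermList => numVars L + n := fun n =>
    nat_add_const primrec_numVars n
  exact primrec_sumSq.comp (list_two primrec_homogenize
    (list_cons.comp (primrec_mulTerm.comp (Primrec.monomial (const 1) primrec_numVars 2)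
        (Primrec.monomial (const 1) (h 1) 2)) <|
      list_cons.comp (const (-1, [])) <|
      list_cons.comp (Primrec.monomial (const (-1)) (h 2) 2) <|
      list_three (Primrec.monomial (const (-1)) (h 3) 2)
        (Primrec.monomial (const (-1)) (h 4) 2) (Primrec.monomial (const (-1)) (h 5) 2)))

/-- The equations `b X_i + a_i = 0` for `i < N`. -/
def pointEqs (N b : ℕ) (as : List ℤ) : List TermList :=
  (List.range N).map fun i => [((b : ℤ), monoExp i 1), (as.getD i 0, [])]

theorem evalTerms_pointEqs (x : ℕ → ℚ) (N b : ℕ) (as : List ℤ) :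
    (∀ M ∈ pointEqs N b as, evalTerms x M = 0) ↔ ∀ i < N, b * x i + as.getD i 0 = 0 := by
  simp [pointEqs]

theorem primrec_pointEqs {α : Type*} [Primcodable α] {N b : α → ℕ} {as : α → List ℤ}
    (hN : Primrec N) (hb : Primrec b) (has : Primrec as) :
    Primrec fun a => pointEqs (N a) (b a) (as a) :=
  list_map (list_range.comp hN) (list_two
    (Primrec.monomial (int_natCast.comp (hb.comp fst)) snd 1)
    (pair ((list_getD 0).comp (has.comp fst) snd) (const []))).to₂

/-- The product of those `i < n` that satisfy `R i b`. -/
def prodWhere {β : Type*} (R : ℕ → β → Prop) [DecidableRel R] (n : ℕ) (b : β) : ℕ :=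
  ((List.range n).map fun i => if R i b then i else 1).prod

theorem primrec_prodWhere {β : Type*} [Primcodable β] {R : ℕ → β → Prop} [DecidableRel R]
    (hR : PrimrecRel R) : Primrec₂ (prodWhere R) :=
  Primrec.list_prod.comp (list_map (list_range.comp fst)
    (Primrec.ite (hR.comp snd (snd.comp fst)) snd (const 1)).to₂)

/-! ### Computability relative to an oracle -/

namespace ComputableIn

open Encodable

variable {α β γ σ : Type*} [Primcodable α] [Primcodable β] [Primcodable γ] [Primcodable σ]
  {O : Set (ℕ →. ℕ)}

theorem comp {g : β → σ} {f : α → β} (hg : ComputableIn O g) (hf : ComputableIn O f) :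
    ComputableIn O fun a => g (f a) :=
  Nat.RecursiveIn.of_eq (Nat.RecursiveIn.comp hg hf) fun n => by
    cases (decode n : Option α) <;> simp

theorem pair {f : α → β} {g : α → γ} (hf : ComputableIn O f) (hg : ComputableIn O g) :
    ComputableIn O fun a => (f a, g a) :=
  Nat.RecursiveIn.of_eq (Nat.RecursiveIn.pair hf hg) fun n => by
    cases (decode n : Option α) <;> simp [Seq.seq]

theorem of_eq {f g : α → σ} (hf : ComputableIn O f) (h : ∀ a, f a = g a) : ComputableIn O g :=
  (funext h : f = g) ▸ hf

theorem nat_rec {f : ℕ → σ} {g : ℕ × σ → σ} (hg : ComputableIn O g)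
    (h : ∀ n, f (n + 1) = g (n, f n)) : ComputableIn O f := by
  have h1 : Nat.RecursiveIn O fun m => Part.bind (decode (α := ℕ × σ) m.unpair.2) fun a =>
      (Part.some (g a)).map encode :=
    Nat.RecursiveIn.of_eq (Nat.RecursiveIn.comp hg Nat.RecursiveIn.right) fun n => by simp
  have h0 : Nat.RecursiveIn O fun _ => Part.some (encode (f 0)) :=
    Nat.Primrec.recursiveIn (Nat.Primrec.const _)
  have h2 := Nat.RecursiveIn.comp (Nat.RecursiveIn.prec h0 h1)
    (Nat.RecursiveIn.pair (Nat.Primrec.recursiveIn (O := O) (Nat.Primrec.const 0))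
      (Nat.Primrec.recursiveIn (O := O) Nat.Primrec.id))
  refine Nat.RecursiveIn.of_eq h2 fun n => ?_
  have key : ∀ m : ℕ, (Nat.rec (Part.some (encode (f 0))) (fun y IH => do
      let i ← IH
      Part.bind (decode (α := ℕ × σ) (Nat.unpair (Nat.pair 0 (Nat.pair y i))).2) fun a =>
        (Part.some (g a)).map encode) m : Part ℕ) = Part.some (encode (f m)) := by
    intro m
    induction m with
    | zero => rfl
    | succ m ih =>
      simp only [ih]
      simp [h]
  simpa [Seq.seq] using key n

theorem find {p : α → ℕ → Bool} (hp : ComputableIn O fun q : α × ℕ => p q.1 q.2)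
    (h : ∀ a, ∃ n, p a n = true) : ComputableIn O fun a => Nat.find (h a) := by
  -- Unbounded search looks for the value 0, so truth is coded by 0.
  have hp' : ComputableIn O fun q : α × ℕ => cond (p q.1 q.2) 0 1 :=
    comp (g := fun b : Bool => cond b 0 1) (Primrec.dom_bool _).computableIn hp
  refine Nat.RecursiveIn.of_eq (Nat.RecursiveIn.rfind hp') fun n => ?_
  cases e : (decode n : Option α) with
  | none =>
    simp [e]
    exact Nat.rfind_zero_none _ rfl
  | some a =>
    simp only [Part.coe_some, Part.bind_some, Part.map_some, Encodable.encode_nat]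
    refine Part.eq_some_iff.2 (Nat.mem_rfind.2 ⟨?_, fun {m} hm => ?_⟩)
    · have := Nat.find_spec (h a)
      simp [e, this]
    · have := Bool.eq_false_iff.2 (Nat.find_min (h a) hm)
      simp [e, this]

end ComputableIn

theorem computableIn_charFun (B : Set ℕ) :
    ComputableIn {(charFun B : ℕ →. ℕ)} (charFun B) :=
  RecursiveIn.oracle _ rfl

theorem DecidableFrom.of_bool {α : Type*} [Primcodable α] {B : Set ℕ} {A : Set α} {f : α → Bool}
    (hf : ComputableIn {(charFun B : ℕ →. ℕ)} f) (h : ∀ a, a ∈ A ↔ f a = true) :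
    DecidableFrom B A := by
  refine (ComputableIn.comp (g := fun b : Bool => cond b 1 0)
    (Primrec.dom_bool _).computableIn hf).of_eq fun a => ?_
  by_cases ha : a ∈ A
  · simp [charFun, ha, (h a).1 ha]
  · simp [charFun, ha, Bool.eq_false_iff.2 fun h' => ha ((h a).2 h')]

/-- Denominators of sums and products divide the product of the denominators, so the condition is
preserved by the ring operations; conversely 1/n is a product of inverses of primes. -/
theorem mem_invertedRing_iff {S : Set ℕ} (hS : ∀ p ∈ S, p.Prime) (x : ℚ) :
    x ∈ invertedRing S ↔ ∀ p : ℕ, p.Prime → p ∣ x.den → p ∈ S := by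
  constructor
  · intro hx
    refine Subring.closure_induction (p := fun x _ => ∀ p : ℕ, p.Prime → p ∣ x.den → p ∈ S)
      ?_ ?_ ?_ ?_ ?_ ?_ hx
    · rintro _ ⟨q, hq, rfl⟩ p hp hpq
      have hq' := hS q hq
      rw [Rat.inv_natCast_den_of_pos hq'.pos] at hpq
      rwa [(Nat.prime_dvd_prime_iff_eq hp hq').1 hpq]
    · intro p hp h
      exact absurd h hp.not_dvd_one
    · intro p hp h
      exact absurd h hp.not_dvd_one
    · intro x y _ _ hx hy p hp h
      exact ((hp.dvd_mul).1 (h.trans (Rat.add_den_dvd x y))).elim (hx p hp) (hy p hp)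
    · intro x _ hx p hp h
      exact hx p hp (by simpa using h)
    · intro x y _ _ hx hy p hp h
      exact ((hp.dvd_mul).1 (h.trans (Rat.mul_den_dvd x y))).elim (hx p hp) (hy p hp)
  · intro h
    have key : ∀ n : ℕ, n ≠ 0 → (∀ p : ℕ, p.Prime → p ∣ n → p ∈ S) → (n : ℚ)⁻¹ ∈ invertedRing S := by
      intro n
      induction n using Nat.recOnMul with
      | zero => intro h; exact absurd rfl h
      | one => intro _ _; simp [one_mem]
      | prime p hp => intro _ h; exact Subring.subset_closure ⟨p, h p hp dvd_rfl, rfl⟩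
      | mul a b iha ihb =>
        intro hab h
        rw [Nat.cast_mul, mul_inv]
        exact mul_mem (iha (left_ne_zero_of_mul hab) fun p hp hd => h p hp (hd.mul_right _))
          (ihb (right_ne_zero_of_mul hab) fun p hp hd => h p hp (hd.mul_left _))
    rw [← Rat.num_div_den x, div_eq_mul_inv]
    exact mul_mem (intCast_mem _ _) (key _ x.den_ne_zero h)

section

variable {β : Type*} {R : ℕ → β → Prop} [DecidableRel R] {b : β}

theorem prodWhere_eq (n : ℕ) : prodWhere R n b = ∏ i ∈ Finset.range n with R i b, i := by
  rw [Finset.prod_filter]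
  rfl

theorem prime_dvd_prodWhere (hR : ∀ i, R i b → i.Prime) {n p : ℕ} (hp : p.Prime) :
    p ∣ prodWhere R n b ↔ p < n ∧ R p b := by
  rw [prodWhere_eq, Prime.dvd_finsetProd_iff hp.prime]
  constructor
  · rintro ⟨i, hi, hpi⟩
    rw [Finset.mem_filter, Finset.mem_range] at hi
    rwa [(Nat.prime_dvd_prime_iff_eq hp (hR i hi.2)).1 hpi]
  · rintro ⟨h1, h2⟩
    exact ⟨p, by simp [h1, h2], dvd_rfl⟩

theorem squarefree_prodWhere (hR : ∀ i, R i b → i.Prime) (n : ℕ) :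
    Squarefree (prodWhere R n b) := by
  rw [prodWhere_eq]
  refine Finset.squarefree_prod_of_pairwise_isCoprime ?_ ?_
  · intro i hi j hj hij
    simp only [Finset.coe_filter, Finset.mem_range, Set.mem_ofPred_eq] at hi hj
    exact Nat.coprime_iff_isRelPrime.1 ((Nat.coprime_primes (hR i hi.2) (hR j hj.2)).2 hij)
  · intro i hi
    rw [Finset.mem_filter] at hi
    exact (hR i hi.2).prime.squarefree

end

/-! ### Coloured primes and the queries of a stage -/

/-- The product of the primes less than `L.length` whose colour in the list `L` is not `j`. -/
def otherProd (L : List ℕ) (j : ℕ) : ℕ :=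
  prodWhere (fun i (q : List ℕ × ℕ) => i.Prime ∧ q.1.getD i 0 ≠ q.2) L.length (L, j)

/-- The product of the primes less than `n` whose colour in the list `L` is `j`. -/
def colorProd (n : ℕ) (L : List ℕ) (j : ℕ) : ℕ :=
  prodWhere (fun i (q : List ℕ × ℕ) => i.Prime ∧ q.1.getD i 0 = q.2) n (L, j)

theorem primrec_otherProd : Primrec₂ otherProd := by
  have hR : PrimrecRel fun i (q : List ℕ × ℕ) => i.Prime ∧ q.1.getD i 0 ≠ q.2 :=
    (PrimrecPred.nat_prime.comp Primrec.fst).and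
      (Primrec.eq.comp ((Primrec.list_getD 0).comp (Primrec.fst.comp Primrec.snd) Primrec.fst)
        (Primrec.snd.comp Primrec.snd)).not
  exact (primrec_prodWhere hR).comp (Primrec.list_length.comp Primrec.fst) Primrec.id

theorem primrec_colorProd :
    Primrec fun q : ℕ × List ℕ × ℕ => colorProd q.1 q.2.1 q.2.2 := by
  have hR : PrimrecRel fun i (q : List ℕ × ℕ) => i.Prime ∧ q.1.getD i 0 = q.2 :=
    (PrimrecPred.nat_prime.comp Primrec.fst).and
      (Primrec.eq.comp ((Primrec.list_getD 0).comp (Primrec.fst.comp Primrec.snd) Primrec.fst)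
        (Primrec.snd.comp Primrec.snd))
  exact (primrec_prodWhere hR).comp Primrec.fst Primrec.snd

theorem prime_dvd_otherProd {L : List ℕ} {j p : ℕ} (hp : p.Prime) :
    p ∣ otherProd L j ↔ p < L.length ∧ L.getD p 0 ≠ j := by
  rw [otherProd, prime_dvd_prodWhere (fun _ h => h.1) hp]
  simp [hp]

theorem squarefree_otherProd (L : List ℕ) (j : ℕ) : Squarefree (otherProd L j) :=
  squarefree_prodWhere (fun _ h => h.1) _

theorem prime_dvd_colorProd {L : List ℕ} {n j p : ℕ} (hp : p.Prime) :
    p ∣ colorProd n L j ↔ p < n ∧ L.getD p 0 = j := by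
  rw [colorProd, prime_dvd_prodWhere (fun _ h => h.1) hp]
  simp [hp]

open scoped Classical in
/-- The least `d` such that `ℚ(√d)` is inert at the primes dividing `P`. -/
noncomputable def inertParam (P : ℕ) : ℕ :=
  Nat.find (p := fun d => decide (InertAt P d) = true)
    ((exists_inertAt P).imp fun _ h => decide_eq_true h)

open scoped Classical in
theorem inertAt_inertParam (P : ℕ) : InertAt P (inertParam P) :=
  of_decide_eq_true (Nat.find_spec (p := fun d => decide (InertAt P d) = true)
    ((exists_inertAt P).imp fun _ h => decide_eq_true h))

open scoped Classical in
theorem computableIn_inertParam (O : Set (ℕ →. ℕ)) : ComputableIn O inertParam :=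
  ComputableIn.find (p := fun P d => decide (InertAt P d)) primrecRel_inertAt.decide.computableIn
    fun P => (exists_inertAt P).imp fun _ h => decide_eq_true h

/-- The index of the polynomial given by a list of terms. -/
def encodeTerms (L : TermList) : ℕ :=
  Encodable.encode L

/-- The list of terms of the polynomial with a given index. -/
def decodeTerms (e : ℕ) : TermList :=
  Denumerable.ofNat TermList e

theorem decodeTerms_encodeTerms (L : TermList) : decodeTerms (encodeTerms L) = L :=
  Denumerable.ofNat_encode L

theorem primrec_encodeTerms : Primrec encodeTerms :=
  Primrec.encode

theorem primrec_decodeTerms : Primrec decodeTerms :=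
  Primrec.ofNat TermList

/-- The index of the query at the stage `s = Nat.pair e j` with list of colours `L`, with the
additional equations `b X_i + a_i = 0` for `i < N`. -/
noncomputable def stageQuery (s : ℕ) (L : List ℕ) (N b : ℕ) (as : List ℤ) : ℕ :=
  encodeTerms (semilocalQuery (decodeTerms s.unpair.1)
    (otherProd L s.unpair.2) (inertParam (otherProd L s.unpair.2)) (pointEqs N b as))

theorem stageQuery_mem_HTP_iff {s : ℕ} {L : List ℕ} {N b : ℕ} {as : List ℤ}
    (hN : N ≤ numVars (decodeTerms s.unpair.1)) :
    stageQuery s L N b as ∈ HTP ℚ ↔ ∃ x : ℕ → ℚ,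
      (∀ i < numVars (decodeTerms s.unpair.1),
        (x i).den.Coprime (otherProd L s.unpair.2)) ∧
      evalTerms x (decodeTerms s.unpair.1) = 0 ∧
      ∀ i < N, b * x i + as.getD i 0 = 0 := by
  rw [mem_HTP_rat_iff, stageQuery, ← decodeTerms, decodeTerms_encodeTerms,
    exists_zero_semilocalQuery_iff (inertAt_inertParam _) (squarefree_otherProd _ _)]
  · simp only [evalTerms_pointEqs]
  · intro M hM x y hxy
    obtain ⟨i, hi, rfl⟩ := List.mem_map.1 hM
    have := hxy i ((List.mem_range.1 hi).trans_le hN)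
    simp [this]

theorem ComputableIn.stageQuery {α : Type*} [Primcodable α] {O : Set (ℕ →. ℕ)} {s : α → ℕ}
    {L : α → List ℕ} {N b : α → ℕ} {as : α → List ℤ} (hs : Primrec s) (hL : Primrec L)
    (hN : Primrec N) (hb : Primrec b) (has : Primrec as) :
    ComputableIn O fun a => stageQuery (s a) (L a) (N a) (b a) (as a) := by
  have hP : Primrec fun a => otherProd (L a) (s a).unpair.2 :=
    primrec_otherProd.comp hL (Primrec.snd.comp (Primrec.unpair.comp hs))
  have hd : ComputableIn O fun a => inertParam (otherProd (L a) (s a).unpair.2) :=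
    (computableIn_inertParam O).comp hP.computableIn
  have hT : Primrec fun a => decodeTerms (s a).unpair.1 :=
    primrec_decodeTerms.comp (Primrec.fst.comp (Primrec.unpair.comp hs))
  have hq : Primrec fun q : α × ℕ => encodeTerms
      (semilocalQuery (decodeTerms (s q.1).unpair.1)
        (otherProd (L q.1) (s q.1).unpair.2) q.2 (pointEqs (N q.1) (b q.1) (as q.1))) :=
    primrec_encodeTerms.comp (primrec_semilocalQuery (hT.comp Primrec.fst) (hP.comp Primrec.fst)
      Primrec.snd (primrec_pointEqs (hN.comp Primrec.fst) (hb.comp Primrec.fst)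
        (has.comp Primrec.fst)))
  exact ComputableIn.comp (f := fun a => (a, inertParam (otherProd (L a) (s a).unpair.2)))
    hq.computableIn (ComputableIn.id.pair hd)

theorem charFun_eq_one_iff {A : Set ℕ} {n : ℕ} : charFun A n = 1 ↔ n ∈ A := by
  by_cases h : n ∈ A <;> simp [charFun, h]

theorem charFun_eq_zero_iff {A : Set ℕ} {n : ℕ} : charFun A n = 0 ↔ n ∉ A := by
  by_cases h : n ∈ A <;> simp [charFun, h]

/-! ### The colouring by stages -/

/-- The search at a stage may stop: either there is no zero to look for, or `K` codes one. -/
noncomputable def stopTest (q : ℕ × List ℕ) (K : ℕ) : Bool :=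
  decide (charFun (HTP ℚ) (stageQuery q.1 q.2 0 0 []) = 0) ||
    decide (charFun (HTP ℚ) (stageQuery q.1 q.2 (numVars (decodeTerms q.1.unpair.1))
      (K.unpair.1 + 1) (Denumerable.ofNat (List ℤ) K.unpair.2)) = 1)

theorem stopTest_eq_true_iff {q : ℕ × List ℕ} {K : ℕ} :
    stopTest q K = true ↔ (stageQuery q.1 q.2 0 0 [] ∈ HTP ℚ →
      stageQuery q.1 q.2 (numVars (decodeTerms q.1.unpair.1)) (K.unpair.1 + 1)
        (Denumerable.ofNat (List ℤ) K.unpair.2) ∈ HTP ℚ) := by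
  simp only [stopTest, Bool.or_eq_true, decide_eq_true_eq, charFun_eq_one_iff,
    charFun_eq_zero_iff]
  tauto

/-- The search terminates because any zero has a common denominator. Candidates are themselves
checked by an oracle question, with the coordinates prescribed by linear equations. -/
theorem exists_stopTest (q : ℕ × List ℕ) : ∃ K, stopTest q K = true := by
  by_cases h : stageQuery q.1 q.2 0 0 [] ∈ HTP ℚ
  swap
  · exact ⟨0, stopTest_eq_true_iff.2 fun h' => absurd h' h⟩
  obtain ⟨x, hx, h0, -⟩ := (stageQuery_mem_HTP_iff (Nat.zero_le _)).1 h
  obtain ⟨b, hb, hbx⟩ := exists_common_den x (numVars (decodeTerms q.1.unpair.1))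
  choose! a ha using hbx
  -- Decoding adds 1, which keeps the denominator positive; the sign comes from the equations b X_i
  -- + a_i = 0.
  refine ⟨Nat.pair (b - 1) (Encodable.encode
    ((List.range (numVars (decodeTerms q.1.unpair.1))).map fun i => -a i)),
    stopTest_eq_true_iff.2 fun _ => (stageQuery_mem_HTP_iff le_rfl).2 ⟨x, hx, h0, fun i hi => ?_⟩⟩
  rw [Nat.unpair_pair, Denumerable.ofNat_encode, Nat.sub_add_cancel hb, ha i hi]
  simp [List.getD_eq_getElem?_getD, hi]

theorem computableIn_stopTest : ComputableIn {(charFun (HTP ℚ) : ℕ →. ℕ)}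
    fun q : (ℕ × List ℕ) × ℕ => stopTest q.1 q.2 := by
  have hs : Primrec fun q : (ℕ × List ℕ) × ℕ => q.1.1 := Primrec.fst.comp Primrec.fst
  have hL : Primrec fun q : (ℕ × List ℕ) × ℕ => q.1.2 := Primrec.snd.comp Primrec.fst
  have hK : Primrec fun q : (ℕ × List ℕ) × ℕ => q.2.unpair := Primrec.unpair.comp Primrec.snd
  have h1 := (computableIn_charFun (HTP ℚ)).comp
    (ComputableIn.stageQuery hs hL (Primrec.const 0) (Primrec.const 0) (Primrec.const []))
  have h2 := (computableIn_charFun (HTP ℚ)).comp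
    (ComputableIn.stageQuery hs hL
      (primrec_numVars.comp (primrec_decodeTerms.comp (Primrec.fst.comp (Primrec.unpair.comp hs))))
      (Primrec.succ.comp (Primrec.fst.comp hK))
      ((Primrec.ofNat (List ℤ)).comp (Primrec.snd.comp hK)))
  have hor : Primrec fun p : ℕ × ℕ => decide (p.1 = 0) || decide (p.2 = 1) :=
    Primrec.or.comp (Primrec.eq.comp Primrec.fst (Primrec.const 0)).decide
      (Primrec.eq.comp Primrec.snd (Primrec.const 1)).decide
  exact ComputableIn.comp hor.computableIn (h1.pair h2)

/-- A common denominator of the zero found at a stage. -/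
noncomputable def searchDen (q : ℕ × List ℕ) : ℕ :=
  (Nat.find (exists_stopTest q)).unpair.1 + 1

/-- The colours after the first half of a stage: room for the denominators of the zero that was
found. -/
noncomputable def stageMid (q : ℕ × List ℕ) : List ℕ :=
  q.2 ++ List.replicate (searchDen q + 1) q.1.unpair.2

/-- The colours at the end of a stage: a long block of the new colour `s` is added. -/
noncomputable def stageEnd (q : ℕ × List ℕ) : List ℕ :=
  stageMid q ++ List.replicate (2 ^ ((q.1 + 1) * (stageMid q).length + 1)) q.1

/-- The list of colours at the beginning of each stage. -/
noncomputable def stages : ℕ → List ℕ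
  | 0 => []
  | s + 1 => stageEnd (s, stages s)

/-- The colour of a number. -/
noncomputable def color (m : ℕ) : ℕ :=
  (stages (m + 1)).getD m 0

/-- The set of primes of colour `j`. -/
noncomputable def colorClass (j : ℕ) : Set ℕ :=
  {p | p.Prime ∧ color p = j}

theorem computableIn_stages : ComputableIn {(charFun (HTP ℚ) : ℕ →. ℕ)} stages := by
  have hden : ComputableIn {(charFun (HTP ℚ) : ℕ →. ℕ)} searchDen :=
    ComputableIn.comp (g := fun K : ℕ => K.unpair.1 + 1)
      (Primrec.succ.comp (Primrec.fst.comp Primrec.unpair)).computableIn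
      (ComputableIn.find computableIn_stopTest exists_stopTest)
  have hmid : ComputableIn {(charFun (HTP ℚ) : ℕ →. ℕ)} stageMid := by
    have h : Primrec fun r : (ℕ × List ℕ) × ℕ => r.1.2 ++ List.replicate (r.2 + 1) r.1.1.unpair.2 :=
      Primrec.list_append.comp (Primrec.snd.comp Primrec.fst) (Primrec.list_replicate.comp
        (Primrec.succ.comp Primrec.snd) (Primrec.snd.comp (Primrec.unpair.comp (Primrec.fst.comp Primrec.fst))))
    exact ComputableIn.comp (f := fun q => (q, searchDen q)) h.computableIn
      (ComputableIn.id.pair hden)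
  have hend : ComputableIn {(charFun (HTP ℚ) : ℕ →. ℕ)} stageEnd := by
    have h : Primrec fun r : (ℕ × List ℕ) × List ℕ =>
        r.2 ++ List.replicate (2 ^ ((r.1.1 + 1) * r.2.length + 1)) r.1.1 :=
      Primrec.list_append.comp Primrec.snd (Primrec.list_replicate.comp
        (Primrec.nat_pow.comp (Primrec.const 2) (Primrec.succ.comp (Primrec.nat_mul.comp
          (Primrec.succ.comp (Primrec.fst.comp Primrec.fst))
          (Primrec.list_length.comp Primrec.snd)))) (Primrec.fst.comp Primrec.fst))
    exact ComputableIn.comp (f := fun q => (q, stageMid q)) h.computableIn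
      (ComputableIn.id.pair hmid)
  exact ComputableIn.nat_rec hend fun _ => rfl

theorem stages_prefix_succ (s : ℕ) : stages s <+: stages (s + 1) :=
  (List.prefix_append _ _).trans (List.prefix_append _ _)

theorem stages_prefix {s t : ℕ} (h : s ≤ t) : stages s <+: stages t := by
  induction t, h using Nat.le_induction with
  | base => exact List.prefix_rfl
  | succ t _ ih => exact ih.trans (stages_prefix_succ t)

theorem length_stages_succ (s : ℕ) : (stages (s + 1)).length =
    (stageMid (s, stages s)).length + 2 ^ ((s + 1) * (stageMid (s, stages s)).length + 1) := by
  simp [stages, stageEnd]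

theorem length_stageMid (q : ℕ × List ℕ) :
    (stageMid q).length = q.2.length + (searchDen q + 1) := by
  simp [stageMid]

/-- Every m is therefore coloured by stage m + 1, and the default value in `color` is never used. -/
theorem le_length_stages (s : ℕ) : s ≤ (stages s).length := by
  induction s with
  | zero => exact Nat.zero_le _
  | succ s ih =>
    rw [length_stages_succ, length_stageMid]
    refine le_trans ?_ (Nat.le_add_right _ _)
    simp only
    omega

theorem List.IsPrefix.getD_eq {α : Type*} {l l' : List α} (h : l <+: l') {i : ℕ}
    (hi : i < l.length) (d : α) : l'.getD i d = l.getD i d := by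
  obtain ⟨t, rfl⟩ := h
  simp [List.getD_eq_getElem?_getD, List.getElem?_append_left hi]

theorem getD_stages {s m : ℕ} (h : m < (stages s).length) : (stages s).getD m 0 = color m := by
  have h' : m < (stages (m + 1)).length := le_length_stages (m + 1)
  rw [color]
  rcases le_total s (m + 1) with hs | hs
  · rw [(stages_prefix hs).getD_eq h]
  · rw [(stages_prefix hs).getD_eq h']

theorem getD_append_replicate {l : List ℕ} {n a i : ℕ} (h1 : l.length ≤ i)
    (h2 : i < l.length + n) : (l ++ List.replicate n a).getD i 0 = a := by
  rw [List.getD_eq_getElem?_getD, List.getElem?_append_right h1, List.getElem?_replicate,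
    if_pos (by omega)]
  rfl

theorem color_of_le_searchDen {s m : ℕ} (h1 : (stages s).length ≤ m)
    (h2 : m ≤ (stages s).length + searchDen (s, stages s)) : color m = s.unpair.2 := by
  have hlt : m < (stageMid (s, stages s)).length := by
    rw [length_stageMid]
    simp only
    omega
  have hpre : stageMid (s, stages s) <+: stages (s + 1) := List.prefix_append _ _
  rw [← getD_stages (s := s + 1) (hlt.trans_le hpre.length_le), hpre.getD_eq hlt]
  exact getD_append_replicate h1 (Nat.lt_succ_of_le h2)

theorem color_of_mid_le {s m : ℕ} (h1 : (stageMid (s, stages s)).length ≤ m)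
    (h2 : m < (stages (s + 1)).length) : color m = s := by
  rw [← getD_stages h2]
  refine getD_append_replicate h1 (h2.trans_eq ?_)
  simp [stages, stageEnd]

theorem mem_invertedRing_colorClass {j : ℕ} {x : ℚ} :
    x ∈ invertedRing (colorClass j) ↔ ∀ p : ℕ, p.Prime → p ∣ x.den → color p = j := by
  rw [mem_invertedRing_iff fun p hp => hp.1]
  exact forall_congr' fun p => forall_congr' fun hp => by simp [colorClass, hp]

/-- A zero in the ring avoids all primes of other colours, in particular those coloured before the
stage. Conversely, a prime in a denominator of the zero found at the stage either was coloured
before, and then has colour j, or divides the common denominator b and falls in the block that the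
stage colours j. -/
theorem mem_HTP_colorClass_iff (e j : ℕ) :
    e ∈ HTP (invertedRing (colorClass j)) ↔
      stageQuery (Nat.pair e j) (stages (Nat.pair e j)) 0 0 [] ∈ HTP ℚ := by
  set s := Nat.pair e j with hs
  have hs1 : s.unpair.1 = e := by simp [hs]
  have hs2 : s.unpair.2 = j := by simp [hs]
  rw [mem_HTP_subring_iff]
  constructor
  · rintro ⟨x, hx, h0⟩
    refine (stageQuery_mem_HTP_iff (Nat.zero_le _)).2 ⟨x, fun i _ => ?_, by rw [hs1]; exact h0,
      fun i hi => absurd hi (Nat.not_lt_zero i)⟩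
    refine Nat.Coprime.symm (Nat.coprime_of_dvd fun p hp hpP hpx => ?_)
    rw [hs2, prime_dvd_otherProd hp] at hpP
    rw [getD_stages hpP.1] at hpP
    exact hpP.2 (mem_invertedRing_colorClass.1 (hx i) p hp hpx)
  · intro h
    have hK := stopTest_eq_true_iff.1 (Nat.find_spec (exists_stopTest (s, stages s))) h
    obtain ⟨x, hx, h0, hbx⟩ := (stageQuery_mem_HTP_iff le_rfl).1 hK
    change ∀ i < _, ((searchDen (s, stages s) : ℕ) : ℚ) * x i + _ = 0 at hbx
    simp only [hs1, hs2] at hx h0 hbx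
    set N := numVars (decodeTerms e)
    -- Only the first N coordinates have controlled denominators; the others do not occur in the
    -- polynomial.
    refine ⟨fun i => if i < N then x i else 0, fun i => ?_, ?_⟩
    · by_cases hi : i < N
      swap
      · simp only [hi, if_false]
        exact Subring.zero_mem _
      simp only [hi, if_true]
      refine mem_invertedRing_colorClass.2 fun p hp hpx => ?_
      have hnp : ¬ p ∣ otherProd (stages s) j := fun hd =>
        hp.one_lt.ne' (Nat.eq_one_of_dvd_coprimes (hx i hi) hpx hd)
      rw [prime_dvd_otherProd hp, not_and, not_not] at hnp
      by_cases hps : p < (stages s).length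
      · rw [← getD_stages hps]
        exact hnp hps
      · have hden : (x i).den ∣ searchDen (s, stages s) := by
          have hb : ((searchDen (s, stages s) : ℕ) : ℚ) ≠ 0 := by
            exact Nat.cast_ne_zero.2 (Nat.succ_ne_zero _)
          have hxi : x i = ((-(Denumerable.ofNat (List ℤ) (Nat.find (exists_stopTest
              (s, stages s))).unpair.2).getD i 0 : ℤ) : ℚ) / (searchDen (s, stages s) : ℤ) := by
            have := hbx i hi
            push_cast
            field_simp
            linarith
          have := Rat.den_dvd (-(Denumerable.ofNat (List ℤ) (Nat.find (exists_stopTest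
              (s, stages s))).unpair.2).getD i 0) (searchDen (s, stages s) : ℤ)
          rw [Rat.divInt_eq_div, ← hxi] at this
          exact_mod_cast this
        have hle := Nat.le_of_dvd (Nat.succ_pos _) (hpx.trans hden)
        rw [color_of_le_searchDen (s := s) (by omega) (by
          change p ≤ searchDen (s, stages s) at hle
          omega), hs2]
    · rw [← h0]
      exact evalTerms_congr fun i hi => if_pos hi

theorem charFun_congr {α β : Type*} {A : Set α} {B : Set β} {a : α} {b : β} (h : a ∈ A ↔ b ∈ B) :
    charFun A a = charFun B b := by
  by_cases hb : b ∈ B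
  · simp [charFun, hb, h.2 hb]
  · simp [charFun, hb, show a ∉ A from fun ha => hb (h.1 ha)]

/-! ### Lower density -/

/-- Bertrand's postulate puts a prime between consecutive powers of 2. -/
theorem le_count_prime_two_pow (k : ℕ) : k ≤ Nat.count Nat.Prime (2 ^ (k + 1)) := by
  induction k with
  | zero => exact Nat.zero_le _
  | succ k ih =>
    obtain ⟨p, hp, h1, h2⟩ := Nat.exists_prime_lt_and_le_two_mul (2 ^ (k + 1)) (by positivity)
    have hlt : p < 2 ^ (k + 1 + 1) := by
      refine lt_of_le_of_ne (h2.trans_eq (by ring)) fun h => ?_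
      exact (Nat.Prime.not_prime_pow (n := k + 1 + 1) (by omega)) (h ▸ hp)
    calc k + 1 ≤ Nat.count Nat.Prime (2 ^ (k + 1)) + 1 := by omega
      _ ≤ Nat.count Nat.Prime p + 1 := by
        exact Nat.succ_le_succ (Nat.count_monotone _ h1.le)
      _ = Nat.count Nat.Prime (p + 1) := by rw [Nat.count_succ, if_pos hp]
      _ ≤ _ := Nat.count_monotone _ hlt

theorem image_nth_prime_Iio_count (n : ℕ) :
    Nat.nth Nat.Prime '' Set.Iio (Nat.count Nat.Prime n) = {p | p.Prime ∧ p < n} := by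
  ext p
  constructor
  · rintro ⟨i, hi, rfl⟩
    exact ⟨Nat.prime_nth_prime i, Nat.nth_lt_of_lt_count hi⟩
  · rintro ⟨hp, hpn⟩
    exact ⟨Nat.count Nat.Prime p, Nat.count_strict_mono hp hpn, Nat.nth_count hp⟩

theorem lowerDensity_eq_zero_of_frequently {S : Set ℕ}
    (h : ∀ s N : ℕ, ∃ n ≥ N, 0 < n ∧
      (s + 1) * (S ∩ Nat.nth Nat.Prime '' Set.Iio n).ncard ≤ n) : lowerDensity S = 0 := by
  have hnn : ∀ n : ℕ, 0 ≤ ((S ∩ Nat.nth Nat.Prime '' Set.Iio n).ncard : ℝ) / n := fun n => by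
    positivity
  have hle : ∀ n : ℕ, ((S ∩ Nat.nth Nat.Prime '' Set.Iio n).ncard : ℝ) / n ≤ 1 := fun n => by
    refine div_le_one_of_le₀ ?_ (Nat.cast_nonneg n)
    have hfin : (Set.Iio n).Finite := Set.finite_Iio n
    calc ((S ∩ Nat.nth Nat.Prime '' Set.Iio n).ncard : ℝ)
        ≤ (Nat.nth Nat.Prime '' Set.Iio n).ncard := by
          exact_mod_cast Set.ncard_le_ncard Set.inter_subset_right (hfin.image _)
      _ ≤ (Set.Iio n).ncard := by exact_mod_cast Set.ncard_image_le hfin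
      _ = n := by simp [Set.ncard_eq_toFinset_card']
  have hbb : Filter.IsBoundedUnder (· ≥ ·) Filter.atTop
      (fun n : ℕ => ((S ∩ Nat.nth Nat.Prime '' Set.Iio n).ncard : ℝ) / n) :=
    Filter.isBoundedUnder_of ⟨0, hnn⟩
  have hba : Filter.IsCoboundedUnder (· ≥ ·) Filter.atTop
      (fun n : ℕ => ((S ∩ Nat.nth Nat.Prime '' Set.Iio n).ncard : ℝ) / n) :=
    (Filter.isBoundedUnder_of ⟨1, hle⟩ : Filter.IsBoundedUnder (· ≤ ·) _ _).isCoboundedUnder_ge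
  refine le_antisymm ?_ (Filter.le_liminf_of_le hba (Filter.Eventually.of_forall hnn))
  refine le_of_forall_pos_le_add fun ε hε => ?_
  rw [zero_add]
  obtain ⟨s, hs⟩ := exists_nat_one_div_lt hε
  refine Filter.liminf_le_of_frequently_le (Filter.frequently_atTop.2 fun N => ?_) hbb
  obtain ⟨n, hn, hn0, hc⟩ := h s N
  refine ⟨n, hn, le_trans ?_ hs.le⟩
  have hn0' : (0 : ℝ) < n := by exact_mod_cast hn0
  rw [div_le_div_iff₀ hn0' (by positivity), one_mul, mul_comm]
  exact_mod_cast hc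

/-- At the end of a stage t > j, the class of j has at most B elements, where B is the position at
which the block of colour t starts, while there are at least (t + 1)B primes. -/
theorem lowerDensity_colorClass (j : ℕ) : lowerDensity (colorClass j) = 0 := by
  refine lowerDensity_eq_zero_of_frequently fun s N => ?_
  -- The stage is at least s for the ratio, at least N for the number of primes, and beyond j so
  -- that its final block avoids colour j.
  obtain ⟨t, ht⟩ : ∃ t, t = s + N + j + 1 := ⟨_, rfl⟩
  obtain ⟨B, hB⟩ : ∃ B, B = (stageMid (t, stages t)).length := ⟨_, rfl⟩
  have hB0 : 0 < B := by rw [hB, length_stageMid]; exact Nat.succ_pos _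
  have hlen : (stages (t + 1)).length = B + 2 ^ ((t + 1) * B + 1) := by
    rw [length_stages_succ, ← hB]
  have hcount : (t + 1) * B ≤ Nat.count Nat.Prime (stages (t + 1)).length :=
    (le_count_prime_two_pow _).trans (Nat.count_monotone _ (hlen ▸ Nat.le_add_left _ _))
  have htB : t + 1 ≤ (t + 1) * B := Nat.le_mul_of_pos_right _ hB0
  refine ⟨Nat.count Nat.Prime (stages (t + 1)).length, by omega, by omega, ?_⟩
  rw [image_nth_prime_Iio_count]
  have hsub : colorClass j ∩ {p | p.Prime ∧ p < (stages (t + 1)).length} ⊆ Set.Iio B := by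
    rintro p ⟨⟨hp, hpj⟩, -, hpl⟩
    by_contra hpB
    have := color_of_mid_le (s := t) (m := p) (hB ▸ not_lt.1 hpB) hpl
    omega
  have hcard : (colorClass j ∩ {p | p.Prime ∧ p < (stages (t + 1)).length}).ncard ≤ B :=
    (Set.ncard_le_ncard hsub (Set.finite_Iio B)).trans_eq (by simp [Set.ncard_eq_toFinset_card'])
  calc (s + 1) * _ ≤ (t + 1) * B := Nat.mul_le_mul (by omega) hcard
    _ ≤ _ := hcount

/-- Bertrand's postulate again: the block of colour s starts at B and is longer than B, so it
contains a prime of (B, 2B]. Nonempty disjoint classes are distinct. -/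
theorem exists_prime_color (s : ℕ) : ∃ p : ℕ, p.Prime ∧ color p = s := by
  obtain ⟨B, hB⟩ : ∃ B, B = (stageMid (s, stages s)).length := ⟨_, rfl⟩
  have hB0 : 0 < B := by rw [hB, length_stageMid]; exact Nat.succ_pos _
  obtain ⟨p, hp, h1, h2⟩ := Nat.exists_prime_lt_and_le_two_mul B hB0.ne'
  refine ⟨p, hp, color_of_mid_le (hB ▸ h1.le) ?_⟩
  rw [length_stages_succ, ← hB]
  have h3 : B < 2 ^ ((s + 1) * B + 1) :=
    Nat.lt_two_pow_self.trans_le (Nat.pow_le_pow_right two_pos (by nlinarith))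
  omega

/-! ### Decidability and Turing equivalence -/

theorem computableIn_color : ComputableIn {(charFun (HTP ℚ) : ℕ →. ℕ)} color := by
  have h : Primrec fun r : List ℕ × ℕ => r.1.getD r.2 0 :=
    (Primrec.list_getD 0).comp Primrec.fst Primrec.snd
  exact ComputableIn.comp (f := fun m => (stages (m + 1), m)) h.computableIn
    ((computableIn_stages.comp (f := fun m => m + 1) ComputableIn.succ).pair ComputableIn.id)

theorem decidableFrom_colorClass :
    DecidableFrom (HTP ℚ) {a : ℕ × ℕ | a.2 ∈ colorClass a.1} := by
  have h : Primrec fun r : (ℕ × ℕ) × ℕ => decide (r.1.2.Prime ∧ r.2 = r.1.1) :=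
    ((PrimrecPred.nat_prime.comp (Primrec.snd.comp Primrec.fst)).and
      (Primrec.eq.comp Primrec.snd (Primrec.fst.comp Primrec.fst))).decide
  refine DecidableFrom.of_bool (f := fun a => decide (a.2.Prime ∧ color a.2 = a.1)) ?_ ?_
  · exact ComputableIn.comp (f := fun a : ℕ × ℕ => (a, color a.2)) h.computableIn
      (ComputableIn.id.pair (computableIn_color.comp ComputableIn.snd))
  · intro a
    simp [colorClass]

/-- The exponent of any prime in n is less than n, so it is at most k. -/
theorem Nat.dvd_pow_of_forall_prime_dvd {n m k : ℕ} (hn : n ≠ 0) (hk : n ≤ k)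
    (h : ∀ p : ℕ, p.Prime → p ∣ n → p ∣ m) : n ∣ m ^ k := by
  rcases eq_or_ne m 0 with rfl | hm
  · rw [zero_pow (by omega)]
    exact dvd_zero n
  rw [← Nat.factorization_le_iff_dvd hn (pow_ne_zero _ hm)]
  intro p
  by_cases hp : p.Prime ∧ p ∣ n
  · rw [Nat.factorization_pow, Finsupp.smul_apply, smul_eq_mul]
    have h1 : n.factorization p < n := Nat.factorization_lt p hn
    have h2 : 0 < m.factorization p := hp.1.factorization_pos_of_dvd hm (h p hp.1 hp.2)
    nlinarith
  · rw [(Nat.factorization_eq_zero_iff n p).2 (by tauto)]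
    exact Nat.zero_le _

/-- Membership becomes a divisibility with no reduction to lowest terms: the reduced denominator
divides b, so it involves only primes up to b, with exponents below b, and `stages (b + 1)` already
colours those primes. -/
theorem div_mem_invertedRing_colorClass_iff {j b : ℕ} {a : ℤ} (hb : b ≠ 0) :
    (a : ℚ) / (b : ℚ) ∈ invertedRing (colorClass j) ↔
      b ∣ a.natAbs * colorProd (b + 1) (stages (b + 1)) j ^ b := by
  have hcol : ∀ p : ℕ, p.Prime → (p ∣ colorProd (b + 1) (stages (b + 1)) j ↔
      p < b + 1 ∧ color p = j) := by
    intro p hp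
    rw [prime_dvd_colorProd hp]
    exact and_congr_right fun h => by rw [getD_stages (h.trans_le (le_length_stages _))]
  obtain ⟨Q, hQ⟩ : ∃ Q, Q = colorProd (b + 1) (stages (b + 1)) j := ⟨_, rfl⟩
  rw [← hQ] at hcol ⊢
  have hbq : (b : ℚ) ≠ 0 := by exact_mod_cast hb
  have hcross : ((a : ℚ) / b).num * b = a * ((a : ℚ) / b).den := by
    have := Rat.mul_den_eq_num ((a : ℚ) / b)
    have h' : ((((a : ℚ) / b).num * b : ℤ) : ℚ) = (a * ((a : ℚ) / b).den : ℤ) := by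
      push_cast
      rw [← this]
      field_simp
    exact_mod_cast h'
  have hden : ((a : ℚ) / b).den ∣ b := by
    have := Rat.den_dvd a b
    rw [Rat.divInt_eq_div] at this
    exact_mod_cast this
  rw [mem_invertedRing_colorClass]
  constructor
  · intro h
    have h1 : ((a : ℚ) / b).den ∣ Q ^ b := by
      refine Nat.dvd_pow_of_forall_prime_dvd (Rat.den_ne_zero _)
        (Nat.le_of_dvd (Nat.pos_of_ne_zero hb) hden) fun p hp hpd => (hcol p hp).2 ⟨?_, h p hp hpd⟩
      exact Nat.lt_succ_of_le (Nat.le_of_dvd (Nat.pos_of_ne_zero hb) (hpd.trans hden))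
    have h2 : (b : ℤ) ∣ a * ((a : ℚ) / b).den := ⟨_, by rw [← hcross, mul_comm]⟩
    have h3 : b ∣ a.natAbs * ((a : ℚ) / b).den := by
      have := Int.natAbs_dvd_natAbs.2 h2
      simpa [Int.natAbs_mul] using this
    exact h3.trans (mul_dvd_mul_left _ h1)
  · intro h p hp hpd
    have h1 : ((a : ℚ) / b).den ∣ Q ^ b := by
      have h2 : (b : ℤ) ∣ a * (Q ^ b : ℕ) := by
        rw [← Int.natAbs_dvd_natAbs, Int.natAbs_mul]
        simpa using h
      obtain ⟨k, hk⟩ := h2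
      have h3 : ((a : ℚ) / b).num * (Q ^ b : ℕ) = ((a : ℚ) / b).den * k := by
        have hbz : (b : ℤ) ≠ 0 := by exact_mod_cast hb
        refine mul_right_cancel₀ hbz ?_
        linear_combination (Q ^ b : ℕ) * hcross + ((a : ℚ) / b).den * hk
      have hc : IsCoprime ((((a : ℚ) / b).den : ℕ) : ℤ) ((a : ℚ) / b).num := by
        rw [isCoprime_comm, Int.isCoprime_iff_nat_coprime]
        exact ((a : ℚ) / b).reduced
      exact Int.natCast_dvd_natCast.1 (hc.dvd_of_dvd_mul_left ⟨k, h3⟩)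
    exact ((hcol p hp).1 (hp.dvd_of_dvd_pow (hpd.trans h1))).2

theorem decidableFrom_invertedRing_colorClass : DecidableFrom (HTP ℚ)
    {a : ℕ × ℤ × ℕ | a.2.2 ≠ 0 ∧ (a.2.1 : ℚ) / (a.2.2 : ℚ) ∈ invertedRing (colorClass a.1)} := by
  have hb : Primrec fun r : (ℕ × ℤ × ℕ) × List ℕ => r.1.2.2 :=
    Primrec.snd.comp (Primrec.snd.comp Primrec.fst)
  have h : Primrec fun r : (ℕ × ℤ × ℕ) × List ℕ => decide (r.1.2.2 ≠ 0 ∧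
      r.1.2.2 ∣ r.1.2.1.natAbs * colorProd (r.1.2.2 + 1) r.2 r.1.1 ^ r.1.2.2) :=
    ((Primrec.eq.comp hb (Primrec.const 0)).not.and (PrimrecRel.nat_dvd.comp hb
      (Primrec.nat_mul.comp (Primrec.int_natAbs.comp (Primrec.fst.comp (Primrec.snd.comp
        Primrec.fst))) (Primrec.nat_pow.comp (primrec_colorProd.comp ((Primrec.succ.comp hb).pair
          (Primrec.snd.pair (Primrec.fst.comp Primrec.fst)))) hb)))).decide
  refine DecidableFrom.of_bool (f := fun a : ℕ × ℤ × ℕ => decide (a.2.2 ≠ 0 ∧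
    a.2.2 ∣ a.2.1.natAbs * colorProd (a.2.2 + 1) (stages (a.2.2 + 1)) a.1 ^ a.2.2)) ?_ ?_
  · exact ComputableIn.comp (f := fun a : ℕ × ℤ × ℕ => (a, stages (a.2.2 + 1))) h.computableIn
      (ComputableIn.id.pair (computableIn_stages.comp (f := fun a : ℕ × ℤ × ℕ => a.2.2 + 1)
        (Primrec.succ.comp (Primrec.snd.comp Primrec.snd)).computableIn))
  · rintro ⟨j, a, b⟩
    simp only [Set.mem_ofPred_eq, decide_eq_true_eq]
    exact and_congr_right fun hb => div_mem_invertedRing_colorClass_iff hb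

/-- One way, compute the colouring up to stage ⟨e, j⟩ and ask the question of that stage; the other
way, the homogeneous query is a many-one reduction. -/
theorem setTuringEquivalent_colorClass (j : ℕ) :
    SetTuringEquivalent (HTP (invertedRing (colorClass j))) (HTP ℚ) := by
  constructor
  · have hs : Primrec fun e : ℕ => Nat.pair e j := Primrec₂.natPair.comp Primrec.id (Primrec.const j)
    have hq : ComputableIn {(charFun (HTP ℚ) : ℕ →. ℕ)} fun r : ℕ × List ℕ =>
        stageQuery r.1 r.2 0 0 [] :=
      ComputableIn.stageQuery Primrec.fst Primrec.snd (Primrec.const 0) (Primrec.const 0)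
        (Primrec.const [])
    have h := (computableIn_charFun (HTP ℚ)).comp (hq.comp (f := fun e : ℕ =>
      (Nat.pair e j, stages (Nat.pair e j)))
        (hs.computableIn.pair (computableIn_stages.comp hs.computableIn)))
    refine h.of_eq fun e => ?_
    exact charFun_congr (mem_HTP_colorClass_iff e j).symm
  · have h := (computableIn_charFun (HTP (invertedRing (colorClass j)))).comp
      ((primrec_encodeTerms.comp (primrec_homQuery.comp primrec_decodeTerms)).computableIn
        (O := {(charFun (HTP (invertedRing (colorClass j))) : ℕ →. ℕ)}))
    refine h.of_eq fun e => ?_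
    have : encodeTerms (homQuery (decodeTerms e)) ∈ HTP (invertedRing (colorClass j)) ↔
        e ∈ HTP ℚ := by
      rw [mem_HTP_subring_iff, ← decodeTerms, decodeTerms_encodeTerms, exists_zero_homQuery_iff,
        mem_HTP_rat_iff, decodeTerms]
    exact charFun_congr this

theorem mainTheorem4 :
    ∃ S : ℕ → Set ℕ,
      Function.Injective S ∧
      (⋃ j, S j) = {p : ℕ | p.Prime} ∧
      (∀ i j : ℕ, i < j → Disjoint (S i) (S j)) ∧
      (∀ j : ℕ, lowerDensity (S j) = 0) ∧
      DecidableFrom (HTP ℚ) {a : ℕ × ℕ | a.2 ∈ S a.1} ∧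
      DecidableFrom (HTP ℚ)
        {a : ℕ × ℤ × ℕ | a.2.2 ≠ 0 ∧ (a.2.1 : ℚ) / (a.2.2 : ℚ) ∈ invertedRing (S a.1)} ∧
      ∀ j : ℕ, SetTuringEquivalent (HTP (invertedRing (S j))) (HTP ℚ) := by
  refine ⟨colorClass, ?_, ?_, ?_, lowerDensity_colorClass, decidableFrom_colorClass,
    decidableFrom_invertedRing_colorClass, setTuringEquivalent_colorClass⟩
  · intro i j hij
    obtain ⟨p, hp, hpi⟩ := exists_prime_color i
    have : p ∈ colorClass j := hij ▸ ⟨hp, hpi⟩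
    exact hpi.symm.trans this.2
  · ext p
    simp [colorClass]
  · intro i j hij
    exact Set.disjoint_left.2 fun p hi hj => hij.ne (hi.2.symm.trans hj.2)
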